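/- **Theorem 1.** Let $(x_i,y_i)\in\mathbb R^p\times\mathbb R$, $i=1,\dots,n$, let $\tau\in(0,1)$, $\lambda>0$, $i^\star\in\{1,\dots,n\}$, $\rho_\tau(r)=\tau\max(r,0)+(1-\tau)\max(-r,0)$, and for $\omega\in[0,1]$ consider the problem $$(P_\omega)\qquad \min_{\beta_0\in\mathbb R,\ \beta\in\mathbb R^p}\ \sum_{i\ne i^\star}\rho_\tau(y_i-\beta_0-x_i^\top\beta)+\omega\,\rho_\tau(y_{i^\star}-\beta_0-x_{i^\star}^\top\beta)+\tfrac{\lambda}{2}\|\beta\|_2^2 .$$ Write $\tilde x_i=(1,x_i^\top)^\top$, and for an index set $A$ let $\tilde X_A$ be the matrix with rows $\tilde x_i^\top$, $i\in A$, and $1_A$ the vector of ones. Assume general position: any $\min(p+2,n)$ of the vectors $(\tilde x_i^\top,y_i)\in\mathbb R^{p+2}$ are linearly independent. *The algorithm.* Start at $\omega_0=1$ from a solution $(\hat\beta_0,\hat\beta)$ of $(P_1)$, with residuals $r_i=y_i-\hat\beta_0-x_i^\top\hat\beta$ and sets $\mathcal L_0=\{r_i<0\}$, $\mathcal E_0=\{r_i=0\}$,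 $\mathcal R_0=\{r_i>0\}$. Put $\theta_i=\tau-1$ on $\mathcal L_0$, $\theta_i=\tau$ on $\mathcal R_0$ and $$\theta_{\mathcal E_0}=(\tilde X_{\mathcal E_0}\tilde X_{\mathcal E_0}^\top)^{-1}\Big[\lambda y_{\mathcal E_0}-\lambda\hat\beta_0 1_{\mathcal E_0}-\tilde X_{\mathcal E_0}\sum_{i\notin\mathcal E_0}\theta_i\tilde x_i\Big].$$ If $i^\star\in\mathcal E_0$, put $\omega_1=\theta_{i^\star}/(\tau-\mathbb I(\theta_{i^\star}<0))$, keep $\hat\beta_0,\hat\beta,\theta,r$ constant on $[\omega_1,1]$ and, if $\omega_1>0$, move $i^\star$ from the elbow set $\mathcal E$ to $\mathcal R$ if $\theta_{i^\star}>0$ and to $\mathcal L$ otherwise. After this, while $\omega_m>0$, put $\sigma=\tau-\mathbb I(i^\star\in\mathcal L_m)$ and, with $\mathcal E=\mathcal E_m$, $G=\tilde X_{\mathcal E}\tilde X_{\mathcal E}^\top$, $$b_{0,m}=\sigma\,\frac{1-1_{\mathcal E}^\top G^{-1}\tilde X_{\mathcal E}\tilde x_{i^\star}}{1_{\mathcal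 E}^\top G^{-1}1_{\mathcal E}},\qquad b_m=-G^{-1}\big[b_{0,m}1_{\mathcal E}+\sigma\tilde X_{\mathcal E}\tilde x_{i^\star}\big],$$ $$h_{i,m}=-b_{0,m}-\tilde x_i^\top\big[\tilde X_{\mathcal E}^\top b_m+\sigma\tilde x_{i^\star}\big]\quad(i=1,\dots,n).$$ For $\omega<\omega_m$ let $\lambda\hat\beta_0$, $\theta_{\mathcal E_m}$, $\lambda r$, $\lambda\hat\beta$ move linearly in $\omega$ with slopes $b_{0,m}$, $b_m$, $h_m$, $X_{\mathcal E_m}^\top b_m+\sigma x_{i^\star}$ (where $X_{\mathcal E_m}$ has rows $x_i^\top$, $i\in\mathcal E_m$), with $\theta_i=\tau-1$ on $\mathcal L_m\setminus\{i^\star\}$, $\theta_i=\tau$ on $\mathcal R_m\setminus\{i^\star\}$ and $\theta_{i^\star}=\omega\sigma$. The next breakpoint $\omega_{m+1}$ is the largest $\omega\in[0,\omega_m)$ at which, moving with nonzero slope, some $\theta_i$ with $i\in\mathcal E_m$ arrives at $\tau$ or $\tau-1$, or some $r_i$ with $i\notin\mathcal E_m$ and $r_i\neq0$ at $\omega_m$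 arrives at $0$; if there is none, the segment extends to $\omega_{m+1}=0$. At $\omega_{m+1}$ the case that attains it moves from $\mathcal E$ to $\mathcal R$ if its $\theta_i$ arrives at $\tau$, from $\mathcal E$ to $\mathcal L$ if its $\theta_i$ arrives at $\tau-1$, and to $\mathcal E$ if its $r_i$ arrives at $0$. *Non-degeneracy.* Assume that at the start $\tau-1<\theta_i<\tau$ for all $i\in\mathcal E_0\setminus\{i^\star\}$. Call a pass through the loop well-defined if $\mathcal E_m\neq\emptyset$ (otherwise the slopes are $0/0$) and if, in case $\omega_{m+1}>0$, exactly one case attains $\omega_{m+1}$. *Conclusion.* 1. If all passes made before the breakpoint $\omega_M$ is reached are well-defined, then for every $\omega\in[\omega_M,1]$ the path $(\hat\beta_{0,\omega},\hat\beta_\omega)$ generated by the algorithm solves $(P_\omega)$. 2. If all passes are well-defined, then the algorithm reaches $\omega_M=0$ after finitely many steps, the path solves $(P_\omega)$ for every $\omega\in[0,1]$, and its value at $\omega=0$ solves the leave-one-out problem of minimizing $\sum_{i\neq i^\star}\rho_\tau(y_i-\beta_0-x_i^\top\beta)+\frac\lambda2\|\beta\|_2^2$. -/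

import Mathlib

open scoped Matrix

noncomputable section

namespace QRPath

open scoped Classical

/-- Input of ridge-penalized linear quantile regression with one distinguished case: covariates
`x i`, responses `y i`, quantile level `tau`, penalty parameter `lam`, and the case `star` whose
weight is varied. -/
structure Data (n p : ℕ) where
  x : Fin n → Fin p → ℝ
  y : Fin n → ℝ
  tau : ℝ
  lam : ℝ
  star : Fin n

/-- Intercept and slope coefficients of a linear fit. -/
@[ext] structure Fit (p : ℕ) where
  b0 : ℝ
  b : Fin p → ℝ

/-- The variables of the path algorithm at a breakpoint: the current case weight `w`, the primal
solution, the dual variables `th`, the residuals `r`, and the three sets (left of the elbow, elbow,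
right of the elbow) in force immediately after that breakpoint. -/
structure State (n p : ℕ) where
  w : ℝ
  fit : Fit p
  th : Fin n → ℝ
  r : Fin n → ℝ
  L : Finset (Fin n)
  E : Finset (Fin n)
  R : Finset (Fin n)

/-- The check loss at quantile level `tau`. -/
def checkLoss (tau r : ℝ) : ℝ := tau * max r 0 + (1 - tau) * max (-r) 0

variable {n p : ℕ}

/-- The augmented covariate vector `(1, x_i)`. -/
def Data.xt (D : Data n p) (i : Fin n) : Fin (p + 1) → ℝ := Fin.cons 1 (D.x i)

/-- The augmented data point `(1, x_i, y_i)`. -/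
def Data.point (D : Data n p) (i : Fin n) : Fin (p + 2) → ℝ := Fin.snoc (D.xt i) (D.y i)

/-- General position: any `min (p + 2) n` of the points `(1, x_i, y_i)` are linearly independent. -/
def Data.GeneralPosition (D : Data n p) : Prop :=
  ∀ s : Finset (Fin n), s.card = min (p + 2) n → LinearIndependent ℝ (fun i : s => D.point i)

/-- The residual of case `i`. -/
def Data.resid (D : Data n p) (f : Fit p) (i : Fin n) : ℝ := D.y i - f.b0 - D.x i ⬝ᵥ f.b

/-- The objective function with weight `w` on the case `star` and weight one on the others. -/
def Data.objective (D : Data n p) (w : ℝ) (f : Fit p) : ℝ :=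
  (∑ i ∈ Finset.univ.erase D.star, checkLoss D.tau (D.resid f i))
    + w * checkLoss D.tau (D.resid f D.star) + D.lam / 2 * ∑ j, f.b j ^ 2

/-- `f` solves the case-weight adjusted problem with weight `w`. -/
def Data.Solves (D : Data n p) (w : ℝ) (f : Fit p) : Prop :=
  ∀ g : Fit p, D.objective w f ≤ D.objective w g

/-- The objective function with the case `star` left out. -/
def Data.looObjective (D : Data n p) (f : Fit p) : ℝ :=
  (∑ i ∈ Finset.univ.erase D.star, checkLoss D.tau (D.resid f i))
    + D.lam / 2 * ∑ j, f.b j ^ 2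

/-- `f` solves the leave-one-out problem. -/
def Data.SolvesLOO (D : Data n p) (f : Fit p) : Prop :=
  ∀ g : Fit p, D.looObjective f ≤ D.looObjective g

/-! ### Quantities computed from an elbow set -/

/-- The rows `(1, x_i)` of the augmented design matrix with `i` in the set `A`. -/
def Data.XE (D : Data n p) (A : Finset (Fin n)) : Matrix A (Fin (p + 1)) ℝ :=
  Matrix.of fun i => D.xt i

/-- The inverse of the Gram matrix of these rows. -/
def Data.gramInv (D : Data n p) (A : Finset (Fin n)) : Matrix A A ℝ :=
  (D.XE A * (D.XE A)ᵀ)⁻¹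

/-- A vector indexed by `A`, extended by zero to all cases. -/
def extend (A : Finset (Fin n)) (v : A → ℝ) (i : Fin n) : ℝ :=
  if h : i ∈ A then v ⟨i, h⟩ else 0

/-- `tau - 1` if the case `star` lies in the left set, `tau` otherwise. -/
def Data.sgn (D : Data n p) (s : State n p) : ℝ := if D.star ∈ s.L then D.tau - 1 else D.tau

/-- The slope of `lam` times the intercept. -/
def Data.slope0 (D : Data n p) (s : State n p) : ℝ :=
  (1 - (1 : s.E → ℝ) ⬝ᵥ (D.gramInv s.E *ᵥ (D.XE s.E *ᵥ D.xt D.star)))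
    / ((1 : s.E → ℝ) ⬝ᵥ (D.gramInv s.E *ᵥ 1)) * D.sgn s

/-- The slopes of the dual variables of the elbow cases, as a vector indexed by the elbow set. -/
def Data.slopeE (D : Data n p) (s : State n p) : s.E → ℝ :=
  -(D.gramInv s.E *ᵥ (D.slope0 s • (1 : s.E → ℝ) + D.sgn s • (D.XE s.E *ᵥ D.xt D.star)))

/-- The same slopes, indexed by the cases. -/
def Data.slopeTh (D : Data n p) (s : State n p) : Fin n → ℝ := extend s.E (D.slopeE s)

/-- The slopes of `lam` times the residuals. -/
def Data.slopeR (D : Data n p) (s : State n p) (i : Fin n) : ℝ :=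
  -D.slope0 s - D.xt i ⬝ᵥ ((D.XE s.E)ᵀ *ᵥ D.slopeE s + D.sgn s • D.xt D.star)

/-! ### Motion between two breakpoints -/

/-- The fit at case weight `w` on the segment that starts at the state `s`. -/
def Data.fitAt (D : Data n p) (s : State n p) (w : ℝ) : Fit p where
  b0 := s.fit.b0 + D.slope0 s * (w - s.w) / D.lam
  b := fun j => s.fit.b j
    + ((∑ i ∈ s.E, D.slopeTh s i * D.x i j) + D.sgn s * D.x D.star j) * (w - s.w) / D.lam

/-- The dual variables at case weight `w` on the segment that starts at the state `s`. -/
def Data.thAt (D : Data n p) (s : State n p) (w : ℝ) (i : Fin n) : ℝ :=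
  if i ∈ s.E then s.th i + D.slopeTh s i * (w - s.w)
  else (if i = D.star then w else 1) * (if i ∈ s.L then D.tau - 1 else D.tau)

/-- The residuals at case weight `w` on the segment that starts at the state `s`. -/
def Data.rAt (D : Data n p) (s : State n p) (w : ℝ) (i : Fin n) : ℝ :=
  s.r i + D.slopeR s i * (w - s.w) / D.lam

/-! ### The next breakpoint -/

/-- The pairs `(i, c)` such that the dual variable of the elbow case `i` reaches the value
`c ∈ {tau, tau - 1}` at some case weight in `[0, s.w)`. -/
def Data.elbowCand (D : Data n p) (s : State n p) : Finset (Fin n × ℝ) :=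
  (s.E ×ˢ {D.tau, D.tau - 1}).filter fun q =>
    -s.w ≤ (q.2 - s.th q.1) / D.slopeTh s q.1 ∧ (q.2 - s.th q.1) / D.slopeTh s q.1 < 0

/-- The case weight at which this happens. -/
def Data.elbowTime (D : Data n p) (s : State n p) (q : Fin n × ℝ) : ℝ :=
  (q.2 - s.th q.1) / D.slopeTh s q.1 + s.w

/-- The cases off the elbow whose residual reaches zero at some case weight in `[0, s.w)`. -/
def Data.sideCand (D : Data n p) (s : State n p) : Finset (Fin n) :=
  (s.L ∪ s.R).filter fun i =>
    0 < D.lam * s.r i / D.slopeR s i ∧ D.lam * s.r i / D.slopeR s i ≤ s.w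

/-- The case weight at which this happens. -/
def Data.sideTime (D : Data n p) (s : State n p) (i : Fin n) : ℝ :=
  -(D.lam * s.r i / D.slopeR s i) + s.w

/-- The first candidate for the next breakpoint (`⊥`, that is `-∞`, if there is none). -/
def Data.cand1 (D : Data n p) (s : State n p) : WithBot ℝ :=
  ((D.elbowCand s).image (D.elbowTime s)).max

/-- The second candidate for the next breakpoint (`⊥`, that is `-∞`, if there is none). -/
def Data.cand2 (D : Data n p) (s : State n p) : WithBot ℝ :=
  ((D.sideCand s).image (D.sideTime s)).max

/-- The larger of the two candidates. -/
def Data.next (D : Data n p) (s : State n p) : WithBot ℝ := max (D.cand1 s) (D.cand2 s)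

/-- The elbow case `i` attains the next breakpoint. -/
def Data.HitsElbow (D : Data n p) (s : State n p) (i : Fin n) : Prop :=
  ∃ c, (i, c) ∈ D.elbowCand s ∧ (D.elbowTime s (i, c) : WithBot ℝ) = D.next s

/-- The case `i` off the elbow attains the next breakpoint. -/
def Data.HitsSide (D : Data n p) (s : State n p) (i : Fin n) : Prop :=
  i ∈ D.sideCand s ∧ (D.sideTime s i : WithBot ℝ) = D.next s

/-! ### The algorithm -/

/-- Initialization, at case weight one, from a fit `f` to the full data. -/
def Data.init (D : Data n p) (f : Fit p) : State n p :=
  let L := Finset.univ.filter fun i => D.resid f i < 0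
  let E := Finset.univ.filter fun i => D.resid f i = 0
  let R := Finset.univ.filter fun i => 0 < D.resid f i
  let thE : E → ℝ := D.gramInv E *ᵥ fun i =>
    D.lam * D.y i - D.lam * f.b0
      - D.xt i ⬝ᵥ ((∑ k ∈ L, (D.tau - 1) • D.xt k) + ∑ k ∈ R, D.tau • D.xt k)
  { w := 1
    fit := f
    th := fun i => if i ∈ L then D.tau - 1 else if i ∈ R then D.tau else extend E thE i
    r := D.resid f
    L := L
    E := E
    R := R }

/-- The first move when `star` lies in the initial elbow set: nothing but the weight changes, until
the dual variable of `star` is at a boundary of its range; there `star` leaves the elbow set. -/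
def Data.release (D : Data n p) (s : State n p) : State n p :=
  let w := s.th D.star / (D.tau - if s.th D.star < 0 then 1 else 0)
  if 0 < w then
    { s with
      w := w
      L := if 0 < s.th D.star then s.L else s.L ∪ {D.star}
      E := s.E \ {D.star}
      R := if 0 < s.th D.star then s.R ∪ {D.star} else s.R }
  else { s with w := w }

/-- One pass through the loop: move to the next breakpoint (to weight zero if there is none), then
move the case that attains it from the elbow set to the right or left set, or to the elbow set. -/
def Data.loopStep (D : Data n p) (s : State n p) : State n p :=
  let w := (D.next s).unbotD 0
  let t : State n p :=
    { s with w := w, fit := D.fitAt s w, th := D.thAt s w, r := D.rAt s w }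
  if h : ∃ i, D.HitsElbow s i then
    if t.th h.choose = D.tau then
      { t with E := s.E \ {h.choose}, R := s.R ∪ {h.choose} }
    else { t with E := s.E \ {h.choose}, L := s.L ∪ {h.choose} }
  else if h : ∃ i, D.HitsSide s i then
    { t with L := s.L \ {h.choose}, E := s.E ∪ {h.choose}, R := s.R \ {h.choose} }
  else t

/-- The state at the `m`-th breakpoint; it stays constant once the weight zero is reached. -/
def Data.run (D : Data n p) (f : Fit p) : ℕ → State n p
  | 0 => D.init f
  | m + 1 =>
    let s := D.run f m
    if m = 0 ∧ D.star ∈ s.E then D.release s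
    else if 0 < s.w then D.loopStep s
    else s

/-- The fit that the algorithm sets at case weight `w`: the given fit `f` at weight one, and for
`w < 1` the value on the segment between two consecutive breakpoints that contains `w`. -/
def Data.path (D : Data n p) (f : Fit p) (w : ℝ) : Fit p :=
  if 1 ≤ w then f
  else
    let m := sInf {m : ℕ | (D.run f (m + 1)).w ≤ w}
    if m = 0 ∧ D.star ∈ (D.run f 0).E then f
    else D.fitAt (D.run f m) w

/-- The `m`-th move of the algorithm is well-defined. A pass through the loop at positive weight
needs a nonempty elbow set (otherwise the slopes are `0 / 0`), and, if it ends at a positive weight,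
exactly one case that attains the next breakpoint. -/
def Data.WellDefinedAt (D : Data n p) (f : Fit p) (m : ℕ) : Prop :=
  let s := D.run f m
  ¬ (m = 0 ∧ D.star ∈ s.E) → 0 < s.w →
    s.E.Nonempty ∧ (0 < (D.run f (m + 1)).w → ∃! i, D.HitsElbow s i ∨ D.HitsSide s i)

end QRPath

end

/-! The problem is convex, so a fit is optimal once it has a dual certificate: numbers θᵢ with Σ θᵢ
= 0 and λβ = Σ θᵢxᵢ, each a subgradient of the weighted check loss at the i-th residual
(`Data.Optimal.solves`). At the given full-data solution, nonnegative directional derivatives of the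
objective show that the algorithm's initial θ is such a certificate (`Data.Solves.init_optimal`).
General position makes the elbow rows independent, hence the Gram matrices invertible.

Between breakpoints everything is affine in ω, and the slopes are those that preserve the
stationarity equations and the zero elbow residuals. The certificate can then fail only if an elbow
θᵢ leaves [τ-1, τ] or a residual changes sign; the next breakpoint is where this first threatens,
provided that cases already at a boundary move inward. This proviso is the core of the invariant
`Data.Inv`.

The crux is that the proviso survives a change of the elbow set. By `Data.slopes_exchange`, the
slope of θᵢ for the larger elbow set times the slope of rᵢ for the smaller one is a squared norm.
Hence a case whose θᵢ arrives at a boundary leaves with its residual moving to the correct side, and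
a case whose residual arrives at zero enters with θᵢ moving into its range. For the distinguished
case, `Data.sgn_mul_slopeR_star` shows that its residual never approaches zero as ω decreases, so it
never returns to the elbow.

For termination: given the three sets and ω, with a nonempty elbow, stationarity and zero elbow
residuals determine fit and θ (`Data.Stationary.unique`). A configuration recurring below the end of
its segment would lie on the extension of that segment, where the case that ended it violates its
constraint. There are finitely many configurations. -/

noncomputable section

namespace QRPath

open scoped Classical

variable {n p : ℕ}

/-! ### Linear algebra of the elbow set -/

/-- The augmented covariate vectors of the cases in `A` are linearly independent. -/
def Data.Indep (D : Data n p) (A : Finset (Fin n)) : Prop :=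
  LinearIndepOn ℝ D.xt (A : Set (Fin n))

@[simp] theorem Data.xt_zero (D : Data n p) (i : Fin n) : D.xt i 0 = 1 := by simp [Data.xt]

@[simp] theorem Data.xt_succ (D : Data n p) (i : Fin n) (j : Fin p) :
    D.xt i j.succ = D.x i j := by simp [Data.xt]

theorem Data.xt_dotProduct (D : Data n p) (i : Fin n) (d : Fin (p + 1) → ℝ) :
    D.xt i ⬝ᵥ d = d 0 + D.x i ⬝ᵥ fun j => d j.succ := by
  simp [dotProduct, Fin.sum_univ_succ]

theorem Data.resid_eq (D : Data n p) (f : Fit p) (i : Fin n) :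
    D.resid f i = D.y i - D.xt i ⬝ᵥ Fin.cons f.b0 f.b := by
  simp [Data.resid, Data.xt_dotProduct, sub_sub]

theorem Data.Indep.coeff_eq_zero {D : Data n p} {A : Finset (Fin n)} (h : D.Indep A)
    (c : Fin n → ℝ) (hc : ∀ j, ∑ i ∈ A, c i * D.xt i j = 0) : ∀ i ∈ A, c i = 0 := by
  refine linearIndepOn_finset_iff.1 h c ?_
  ext j
  simpa [Finset.sum_apply] using hc j

theorem Data.Indep.mono {D : Data n p} {A B : Finset (Fin n)} (h : D.Indep B) (hAB : A ⊆ B) :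
    D.Indep A :=
  LinearIndepOn.mono h (by exact_mod_cast hAB)

/-- In general position, the augmented covariates of the cases with zero residual are linearly
independent. -/
theorem Data.GeneralPosition.indep {D : Data n p} (hgp : D.GeneralPosition) (f : Fit p)
    (A : Finset (Fin n)) (hA : ∀ i ∈ A, D.resid f i = 0) : D.Indep A := by
  -- With zero residuals the response is one fixed linear function of the augmented covariates, so a
  -- relation among the covariates is a relation among the full points.
  have small : ∀ B ⊆ A, B.card ≤ min (p + 2) n → D.Indep B := by
    intro B hBA hB
    obtain ⟨s, hBs, hs⟩ := Finset.exists_superset_card_eq hB (by simp)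
    have hpt : LinearIndepOn ℝ D.point (B : Set (Fin n)) :=
      LinearIndepOn.mono (t := (B : Set (Fin n))) (s := (s : Set (Fin n))) (hgp s hs) (by exact_mod_cast hBs)
    refine linearIndepOn_finset_iff.2 fun c hc => linearIndepOn_finset_iff.1 hpt c ?_
    have hy : ∀ i ∈ B, D.y i = D.xt i ⬝ᵥ Fin.cons f.b0 f.b := fun i hi => by
      have := hA i (hBA hi)
      rw [Data.resid_eq] at this
      linarith
    ext j
    refine Fin.lastCases ?_ (fun j => ?_) j
    · have h1 : (∑ i ∈ B, c i • D.xt i) ⬝ᵥ Fin.cons f.b0 f.b = 0 := by simp [hc]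
      rw [sum_dotProduct] at h1
      simp only [Finset.sum_apply, Pi.smul_apply, Data.point, Fin.snoc_last, smul_eq_mul,
        Pi.zero_apply]
      rw [← h1]
      exact Finset.sum_congr rfl fun i hi => by rw [smul_dotProduct, ← hy i hi, smul_eq_mul]
    · have := congrFun hc j
      simpa [Finset.sum_apply, Data.point] using this
  -- A larger `A` cannot occur: it would contain p + 2 independent vectors of a space of dimension p
  -- + 1.
  rcases le_or_gt A.card (min (p + 2) n) with h | h
  · exact small A subset_rfl h
  · have hn : A.card ≤ n := by simpa using A.card_le_univ
    have hmin : min (p + 2) n = p + 2 := by omega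
    obtain ⟨B, hBA, hB⟩ := Finset.exists_subset_card_eq h.le
    have := LinearIndependent.fintype_card_le_finrank (small B hBA hB.le)
    simp at this
    omega

theorem Data.Indep.gram_posDef {D : Data n p} {A : Finset (Fin n)} (h : D.Indep A) :
    (D.XE A * (D.XE A)ᵀ).PosDef := by
  have := Matrix.PosDef.mul_conjTranspose_self (D.XE A)
    (Matrix.vecMul_injective_iff.2 (show LinearIndependent ℝ (D.XE A).row from h))
  rwa [Matrix.conjTranspose_eq_transpose_of_trivial] at this

theorem Data.Indep.gram_mul_inv {D : Data n p} {A : Finset (Fin n)} (h : D.Indep A) :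
    D.XE A * (D.XE A)ᵀ * D.gramInv A = 1 :=
  Matrix.mul_nonsing_inv _ ((Matrix.isUnit_iff_isUnit_det _).1 h.gram_posDef.isUnit)

theorem extend_of_mem {A : Finset (Fin n)} (v : A → ℝ) {i : Fin n} (h : i ∈ A) :
    extend A v i = v ⟨i, h⟩ := by simp [extend, h]

theorem extend_of_notMem {A : Finset (Fin n)} (v : A → ℝ) {i : Fin n} (h : i ∉ A) :
    extend A v i = 0 := by simp [extend, h]

theorem sum_extend_mul (A : Finset (Fin n)) (v : A → ℝ) (g : Fin n → ℝ) :
    ∑ i ∈ A, extend A v i * g i = ∑ i : A, v i * g i := by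
  rw [← Finset.sum_coe_sort]
  exact Finset.sum_congr rfl fun i _ => by rw [extend_of_mem v i.2]

theorem Data.XE_transpose_mulVec (D : Data n p) (A : Finset (Fin n)) (v : A → ℝ)
    (j : Fin (p + 1)) : ((D.XE A)ᵀ *ᵥ v) j = ∑ i ∈ A, extend A v i * D.xt i j := by
  rw [sum_extend_mul A v fun i => D.xt i j]
  simp [Matrix.mulVec, dotProduct, Data.XE, mul_comm]

/-! ### The slopes -/

/-- The slope of `lam` times the coefficients, with first component the (vanishing) sum of the
slopes of the dual variables. -/
def Data.dir (D : Data n p) (s : State n p) : Fin (p + 1) → ℝ :=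
  fun j => (∑ i ∈ s.E, D.slopeTh s i * D.xt i j) + D.sgn s * D.xt D.star j

theorem Data.slopeTh_of_notMem (D : Data n p) (s : State n p) {i : Fin n} (h : i ∉ s.E) :
    D.slopeTh s i = 0 := extend_of_notMem _ h

theorem Data.dir_eq (D : Data n p) (s : State n p) :
    D.dir s = (D.XE s.E)ᵀ *ᵥ D.slopeE s + D.sgn s • D.xt D.star := by
  ext j
  simp [Data.dir, Data.XE_transpose_mulVec, Data.slopeTh]

theorem Data.slopeR_eq (D : Data n p) (s : State n p) (i : Fin n) :
    D.slopeR s i = -D.slope0 s - D.xt i ⬝ᵥ D.dir s := by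
  rw [Data.dir_eq, Data.slopeR]

/-- The slopes of the elbow dual variables balance the motion of the distinguished case. -/
theorem Data.sum_slopeTh {D : Data n p} {s : State n p} (hI : D.Indep s.E) (hne : s.E.Nonempty) :
    ∑ i ∈ s.E, D.slopeTh s i = -D.sgn s := by
  have : Nonempty s.E := hne.to_subtype
  -- This is the denominator of `slope0`; nonemptiness of the elbow set keeps it from being zero.
  have hpos : 0 < (1 : s.E → ℝ) ⬝ᵥ (D.gramInv s.E *ᵥ 1) := by
    have := hI.gram_posDef.inv.dotProduct_mulVec_pos (x := 1) one_ne_zero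
    rwa [star_one] at this
  have h1 := sum_extend_mul s.E (D.slopeE s) 1
  simp only [Pi.one_apply, mul_one] at h1
  have h2 : ∑ i : s.E, D.slopeE s i = (1 : s.E → ℝ) ⬝ᵥ D.slopeE s := by simp [dotProduct]
  rw [Data.slopeTh, h1, h2, Data.slopeE, Matrix.mulVec_add, Matrix.mulVec_smul, Matrix.mulVec_smul,
    dotProduct_neg, dotProduct_add, dotProduct_smul, dotProduct_smul, Data.slope0]
  simp only [smul_eq_mul]
  field_simp
  ring

/-- The residuals of the elbow cases do not move. -/
theorem Data.slopeR_elbow {D : Data n p} {s : State n p} (hI : D.Indep s.E) :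
    ∀ i ∈ s.E, D.slopeR s i = 0 := by
  intro i hi
  have h : D.XE s.E *ᵥ D.dir s = -(D.slope0 s • (1 : s.E → ℝ)) := by
    rw [Data.dir_eq, Matrix.mulVec_add, Matrix.mulVec_mulVec, Data.slopeE, Matrix.mulVec_neg,
      Matrix.mulVec_mulVec, hI.gram_mul_inv, Matrix.one_mulVec, Matrix.mulVec_smul]
    abel
  have h1 := congrFun h ⟨i, hi⟩
  have h2 : (D.XE s.E *ᵥ D.dir s) ⟨i, hi⟩ = D.xt i ⬝ᵥ D.dir s := rfl
  rw [h2] at h1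
  rw [Data.slopeR_eq, h1]
  simp

/-- With a vanishing first component, pairing `dir` with an augmented row sees only the motion of β;
the intercept moves by `slope0` alone. -/
theorem Data.dir_zero {D : Data n p} {s : State n p} (hI : D.Indep s.E) (hne : s.E.Nonempty) :
    D.dir s 0 = 0 := by
  simp [Data.dir, D.sum_slopeTh hI hne]

theorem Data.dir_dotProduct (D : Data n p) (s : State n p) (v : Fin (p + 1) → ℝ) :
    D.dir s ⬝ᵥ v = (∑ i ∈ s.E, D.slopeTh s i * (D.xt i ⬝ᵥ v))
      + D.sgn s * (D.xt D.star ⬝ᵥ v) := by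
  have : D.dir s = (∑ i ∈ s.E, D.slopeTh s i • D.xt i) + D.sgn s • D.xt D.star := by
    ext j; simp [Data.dir, Finset.sum_apply]
  rw [this, add_dotProduct, sum_dotProduct, smul_dotProduct]
  simp [smul_dotProduct]

/-- Expand one factor of `dir ⬝ᵥ dir` over the cases. Every elbow row pairs with `dir` to `-slope0`,
and the elbow slopes sum to `-sgn`, so only the residual slope of `star` remains. -/
theorem Data.sgn_mul_slopeR_star {D : Data n p} {s : State n p} (hI : D.Indep s.E)
    (hne : s.E.Nonempty) : D.sgn s * D.slopeR s D.star = -(D.dir s ⬝ᵥ D.dir s) := by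
  have h : ∀ i ∈ s.E, D.slopeTh s i * (D.xt i ⬝ᵥ D.dir s) = D.slopeTh s i * -D.slope0 s := by
    intro i hi
    have := D.slopeR_elbow hI i hi
    rw [Data.slopeR_eq] at this
    congr 1
    linarith
  rw [Data.dir_dotProduct, Finset.sum_congr rfl h, ← Finset.sum_mul, D.sum_slopeTh hI hne,
    Data.slopeR_eq]
  ring

theorem Data.sgn_mul_slopeR_star_nonpos {D : Data n p} {s : State n p} (hI : D.Indep s.E)
    (hne : s.E.Nonempty) : D.sgn s * D.slopeR s D.star ≤ 0 := by
  rw [D.sgn_mul_slopeR_star hI hne]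
  have : 0 ≤ D.dir s ⬝ᵥ D.dir s := Finset.sum_nonneg fun i _ => mul_self_nonneg _
  linarith

/-- Equality would make `dir` zero, a linear relation among the rows of the elbow and `star` in
which `star` has the nonzero coefficient `sgn`. -/
theorem Data.sgn_mul_slopeR_star_neg {D : Data n p} {s : State n p} (hstar : D.star ∉ s.E)
    (hI : D.Indep (insert D.star s.E)) (hne : s.E.Nonempty) (hs : D.sgn s ≠ 0) :
    D.sgn s * D.slopeR s D.star < 0 := by
  have hI' := hI.mono (Finset.subset_insert _ _)
  refine lt_of_le_of_ne (D.sgn_mul_slopeR_star_nonpos hI' hne) fun h0 => hs ?_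
  rw [D.sgn_mul_slopeR_star hI' hne, neg_eq_zero, dotProduct_self_eq_zero] at h0
  have := hI.coeff_eq_zero (fun i => if i = D.star then D.sgn s else D.slopeTh s i) (fun j => by
    rw [Finset.sum_insert hstar, Finset.sum_congr rfl (g := fun i => D.slopeTh s i * D.xt i j)]
    · have := congrFun h0 j
      simp only [Data.dir, Pi.zero_apply] at this
      simp only [if_true]
      linarith
    · intro i hi
      rw [if_neg (show i ≠ D.star from fun h => hstar (h ▸ hi))])
  simpa using this D.star (Finset.mem_insert_self _ _)

/-- When a single case enters or leaves the elbow set, the slope of its dual variable in the larger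
elbow set and the slope of its residual for the smaller elbow set have the same sign. -/
theorem Data.slopes_exchange {D : Data n p} {s t : State n p} {i : Fin n} (hi : i ∉ s.E)
    (ht : t.E = insert i s.E) (hI : D.Indep t.E) (hne : s.E.Nonempty) (hs : D.sgn t = D.sgn s) :
    0 < D.slopeTh t i * D.slopeR s i ∨ (D.slopeTh t i = 0 ∧ D.slopeR s i = 0) := by
  have hsub : s.E ⊆ t.E := ht ▸ Finset.subset_insert _ _
  have hI' := hI.mono hsub
  have hne' : t.E.Nonempty := hne.mono hsub
  have hsum : ∀ v : Fin n → ℝ, ∑ k ∈ t.E, D.slopeTh s k * v k = ∑ k ∈ s.E, D.slopeTh s k * v k := by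
    intro v
    rw [ht, Finset.sum_insert hi, D.slopeTh_of_notMem s hi]
    simp
  have hdiff : ∀ v, (D.dir t - D.dir s) ⬝ᵥ v
      = ∑ k ∈ t.E, (D.slopeTh t k - D.slopeTh s k) * (D.xt k ⬝ᵥ v) := by
    intro v
    simp only [sub_mul, Finset.sum_sub_distrib]
    rw [sub_dotProduct, Data.dir_dotProduct, Data.dir_dotProduct, hs,
      hsum fun k => D.xt k ⬝ᵥ v]
    ring
  have htot : ∑ k ∈ t.E, (D.slopeTh t k - D.slopeTh s k) = 0 := by
    have := hsum 1
    simp only [Pi.one_apply, mul_one] at this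
    rw [Finset.sum_sub_distrib, this, D.sum_slopeTh hI hne', D.sum_slopeTh hI' hne, hs, sub_self]
  -- The intercept terms drop out because the coefficients sum to zero. Residual slopes for `t`
  -- vanish on `t.E` and those for `s` vanish on `s.E`, so only the term of `i` survives.
  have hsq : (D.dir t - D.dir s) ⬝ᵥ (D.dir t - D.dir s) = D.slopeTh t i * D.slopeR s i := by
    have hk : ∀ k ∈ t.E, (D.slopeTh t k - D.slopeTh s k) * (D.xt k ⬝ᵥ (D.dir t - D.dir s))
        = (D.slopeTh t k - D.slopeTh s k) * (D.slope0 s - D.slope0 t)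
          + (D.slopeTh t k - D.slopeTh s k) * D.slopeR s k := by
      intro k hk
      have := D.slopeR_elbow hI k hk
      rw [Data.slopeR_eq] at this
      rw [Data.slopeR_eq, dotProduct_sub, ← mul_add]
      congr 1
      linarith
    rw [hdiff, Finset.sum_congr rfl hk, Finset.sum_add_distrib, ← Finset.sum_mul, htot, ht,
      Finset.sum_insert hi, D.slopeTh_of_notMem s hi, Finset.sum_eq_zero]
    · ring
    · intro k hk
      rw [D.slopeR_elbow hI' k hk, mul_zero]
  rcases (Finset.sum_nonneg fun j _ => mul_self_nonneg _ :
    0 ≤ (D.dir t - D.dir s) ⬝ᵥ (D.dir t - D.dir s)).lt_or_eq with h | h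
  · exact Or.inl (hsq ▸ h)
  -- If the two directions agree, independence equates the dual slopes, and any common elbow case
  -- `k` equates the intercept slopes; so `slopeR s i = slopeR t i = 0`.
  · right
    have h0 := dotProduct_self_eq_zero.1 h.symm
    have hc := hI.coeff_eq_zero (fun k => D.slopeTh t k - D.slopeTh s k) fun j => by
      have := hdiff (Pi.single j 1)
      simpa [h0] using this.symm
    have hit : i ∈ t.E := ht ▸ Finset.mem_insert_self _ _
    refine ⟨by simpa [D.slopeTh_of_notMem s hi] using hc i hit, ?_⟩
    obtain ⟨k, hk⟩ := hne
    have e := sub_eq_zero.1 h0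
    have h1 := D.slopeR_elbow hI' k hk
    have h2 := D.slopeR_elbow hI k (hsub hk)
    have h3 := D.slopeR_elbow hI i hit
    rw [Data.slopeR_eq] at h1 h2 h3 ⊢
    rw [e] at h2 h3
    linarith


/-! ### Optimality conditions -/

/-- The weight of a case in the problem with weight `w` on the case `star`. -/
def Data.weight (D : Data n p) (w : ℝ) (i : Fin n) : ℝ := if i = D.star then w else 1

/-- The linear equations that couple a fit with its dual variables. -/
structure Data.Stationary (D : Data n p) (f : Fit p) (th : Fin n → ℝ) : Prop where
  sum_eq : ∑ i, th i = 0
  coef_eq : ∀ j, D.lam * f.b j = ∑ i, th i * D.x i j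

/-- The optimality conditions of the problem with weight `w`: the equations of `Stationary`, with
each dual variable a subgradient of the corresponding weighted loss. -/
structure Data.Optimal (D : Data n p) (w : ℝ) (f : Fit p) (th : Fin n → ℝ) : Prop
    extends D.Stationary f th where
  ge : ∀ i, D.weight w i * (D.tau - 1) ≤ th i
  le : ∀ i, th i ≤ D.weight w i * D.tau
  of_pos : ∀ i, 0 < D.resid f i → th i = D.weight w i * D.tau
  of_neg : ∀ i, D.resid f i < 0 → th i = D.weight w i * (D.tau - 1)

theorem checkLoss_of_nonneg (tau : ℝ) {r : ℝ} (h : 0 ≤ r) : checkLoss tau r = tau * r := by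
  rw [checkLoss, max_eq_left h, max_eq_right (by linarith)]
  ring

theorem checkLoss_of_nonpos (tau : ℝ) {r : ℝ} (h : r ≤ 0) :
    checkLoss tau r = (tau - 1) * r := by
  rw [checkLoss, max_eq_right h, max_eq_left (by linarith)]
  ring

theorem Data.objective_eq (D : Data n p) (w : ℝ) (f : Fit p) :
    D.objective w f = ∑ i, D.weight w i * checkLoss D.tau (D.resid f i)
      + D.lam / 2 * ∑ j, f.b j ^ 2 := by
  rw [Data.objective, ← Finset.sum_erase_add _ _ (Finset.mem_univ D.star)]
  congr 2
  · refine Finset.sum_congr rfl fun i hi => ?_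
    rw [Data.weight, if_neg (Finset.ne_of_mem_erase hi), one_mul]
  · simp [Data.weight]

theorem Data.Stationary.sum_mul_dotProduct {D : Data n p} {f : Fit p} {th : Fin n → ℝ}
    (h : D.Stationary f th) (v : Fin p → ℝ) :
    ∑ i, th i * (D.x i ⬝ᵥ v) = D.lam * ∑ j, f.b j * v j := by
  simp only [dotProduct, Finset.mul_sum]
  rw [Finset.sum_comm]
  refine Finset.sum_congr rfl fun j _ => ?_
  rw [← mul_assoc, h.coef_eq, Finset.sum_mul]
  exact Finset.sum_congr rfl fun i _ => by ring

/-- Sum the subgradient inequalities over the cases. Stationarity makes their linear terms cancel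
the first-order term of the ridge penalty, which leaves a nonnegative square. -/
theorem Data.Optimal.solves {D : Data n p} {w : ℝ} {f : Fit p} {th : Fin n → ℝ}
    (hlam : 0 < D.lam) (h : D.Optimal w f th) : D.Solves w f := by
  intro g
  have hloss : ∀ i, D.weight w i * checkLoss D.tau (D.resid f i)
      + th i * (D.resid g i - D.resid f i) ≤ D.weight w i * checkLoss D.tau (D.resid g i) := by
    intro i
    have h1 : D.weight w i * checkLoss D.tau (D.resid f i) = th i * D.resid f i := by
      rcases lt_trichotomy (D.resid f i) 0 with hr | hr | hr
      · rw [checkLoss_of_nonpos _ hr.le, h.of_neg i hr]; ring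
      · simp [hr, checkLoss]
      · rw [checkLoss_of_nonneg _ hr.le, h.of_pos i hr]; ring
    have h2 : th i * D.resid g i ≤ D.weight w i * checkLoss D.tau (D.resid g i) := by
      rcases le_total (D.resid g i) 0 with hr | hr
      · rw [checkLoss_of_nonpos _ hr, ← mul_assoc]
        exact mul_le_mul_of_nonpos_right (h.ge i) hr
      · rw [checkLoss_of_nonneg _ hr, ← mul_assoc]
        exact mul_le_mul_of_nonneg_right (h.le i) hr
    linarith
  have hsum := Finset.sum_le_sum fun i (_ : i ∈ Finset.univ) => hloss i
  rw [Finset.sum_add_distrib] at hsum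
  have hlin : ∑ i, th i * (D.resid g i - D.resid f i)
      = -(D.lam * ∑ j, f.b j * (g.b j - f.b j)) := by
    rw [← h.sum_mul_dotProduct fun j => g.b j - f.b j, ← Finset.sum_neg_distrib]
    have : ∑ i, th i * (g.b0 - f.b0) = 0 := by rw [← Finset.sum_mul, h.sum_eq, zero_mul]
    rw [← add_zero (∑ i, -_), ← neg_zero, ← this, ← Finset.sum_neg_distrib,
      ← Finset.sum_add_distrib]
    refine Finset.sum_congr rfl fun i _ => ?_
    have : (D.x i ⬝ᵥ fun j => g.b j - f.b j) = D.x i ⬝ᵥ g.b - D.x i ⬝ᵥ f.b := dotProduct_sub _ _ _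
    rw [this, Data.resid, Data.resid]
    ring
  have hsq : ∑ j, g.b j ^ 2 = ∑ j, f.b j ^ 2 + 2 * ∑ j, f.b j * (g.b j - f.b j)
      + ∑ j, (g.b j - f.b j) ^ 2 := by
    rw [Finset.mul_sum, ← Finset.sum_add_distrib, ← Finset.sum_add_distrib]
    exact Finset.sum_congr rfl fun j _ => by ring
  have hnn : 0 ≤ D.lam * ∑ j, (g.b j - f.b j) ^ 2 :=
    mul_nonneg hlam.le (Finset.sum_nonneg fun j _ => sq_nonneg _)
  rw [Data.objective_eq, Data.objective_eq, hsq]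
  linarith

/-! ### Dual variables of a solution of the full-data problem -/

/-- The directional derivative of the check loss at `r` in direction `a`. -/
def checkLossDeriv (tau r a : ℝ) : ℝ :=
  if r < 0 then (tau - 1) * a else if 0 < r then tau * a else checkLoss tau a

open Filter Topology in
-- The loss is piecewise linear, so its first-order expansion is exact for all small positive `t`.
theorem eventually_checkLoss_add (tau r a : ℝ) :
    ∀ᶠ t in 𝓝[>] (0 : ℝ),
      checkLoss tau (r + t * a) = checkLoss tau r + t * checkLossDeriv tau r a := by
  have hlim : Tendsto (fun t : ℝ => r + t * a) (𝓝[>] 0) (𝓝 r) := by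
    have : Tendsto (fun t : ℝ => r + t * a) (𝓝 0) (𝓝 (r + 0 * a)) :=
      (by fun_prop : Continuous fun t : ℝ => r + t * a).tendsto 0
    rw [zero_mul, add_zero] at this
    exact this.mono_left nhdsWithin_le_nhds
  rcases lt_trichotomy r 0 with hr | hr | hr
  · filter_upwards [hlim.eventually_lt_const hr] with t ht
    rw [checkLoss_of_nonpos _ ht.le, checkLoss_of_nonpos _ hr.le, checkLossDeriv, if_pos hr]
    ring
  · filter_upwards [self_mem_nhdsWithin] with t ht
    have ht' : (0 : ℝ) < t := ht
    subst hr
    have h0 : checkLoss tau 0 = 0 := by simp [checkLoss]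
    rw [checkLossDeriv, if_neg (lt_irrefl _), if_neg (lt_irrefl _), zero_add, h0, zero_add]
    rcases le_total a 0 with ha | ha
    · rw [checkLoss_of_nonpos _ ha, checkLoss_of_nonpos _ (mul_nonpos_of_nonneg_of_nonpos ht'.le ha)]
      ring
    · rw [checkLoss_of_nonneg _ ha, checkLoss_of_nonneg _ (mul_nonneg ht'.le ha)]
      ring
  · filter_upwards [hlim.eventually_const_lt hr] with t ht
    rw [checkLoss_of_nonneg _ ht.le, checkLoss_of_nonneg _ hr.le, checkLossDeriv,
      if_neg (not_lt.2 hr.le), if_pos hr]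
    ring

open Filter Topology in
/-- The directional derivatives of the objective function at a solution are nonnegative. -/
theorem Data.Solves.deriv_nonneg {D : Data n p} {f : Fit p} (hf : D.Solves 1 f)
    (d : Fin (p + 1) → ℝ) :
    0 ≤ ∑ i, checkLossDeriv D.tau (D.resid f i) (-(D.xt i ⬝ᵥ d))
      + D.lam * ∑ j, f.b j * d j.succ := by
  set A := ∑ i, checkLossDeriv D.tau (D.resid f i) (-(D.xt i ⬝ᵥ d))
      + D.lam * ∑ j, f.b j * d j.succ with hA
  have hw : ∀ i, D.weight 1 i = 1 := fun i => by simp [Data.weight]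
  -- This is the increment of the objective divided by `t`; only the ridge penalty contributes
  -- beyond first order.
  have hev : ∀ᶠ t in 𝓝[>] (0 : ℝ), 0 ≤ A + t * (D.lam / 2 * ∑ j : Fin p, d j.succ ^ 2) := by
    have := eventually_all.2 fun i =>
      eventually_checkLoss_add D.tau (D.resid f i) (-(D.xt i ⬝ᵥ d))
    filter_upwards [this, self_mem_nhdsWithin] with t ht ht0
    have ht0 : (0 : ℝ) < t := ht0
    have key := hf ⟨f.b0 + t * d 0, fun j => f.b j + t * d j.succ⟩
    have hr : ∀ i, D.resid ⟨f.b0 + t * d 0, fun j => f.b j + t * d j.succ⟩ i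
        = D.resid f i + t * (-(D.xt i ⬝ᵥ d)) := by
      intro i
      have : (D.x i ⬝ᵥ fun j => f.b j + t * d j.succ)
          = D.x i ⬝ᵥ f.b + t * (D.x i ⬝ᵥ fun j => d j.succ) := by
        rw [← smul_eq_mul, ← dotProduct_smul, ← dotProduct_add]
        rfl
      simp only [Data.resid, this, Data.xt_dotProduct]
      ring
    have hsq : ∑ j, (f.b j + t * d j.succ) ^ 2
        = ∑ j, f.b j ^ 2 + 2 * t * ∑ j, f.b j * d j.succ + t ^ 2 * ∑ j : Fin p, d j.succ ^ 2 := by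
      rw [Finset.mul_sum, Finset.mul_sum, ← Finset.sum_add_distrib, ← Finset.sum_add_distrib]
      exact Finset.sum_congr rfl fun j _ => by ring
    rw [Data.objective_eq, Data.objective_eq] at key
    simp only [hw, one_mul, hr, ht, hsq, Finset.sum_add_distrib, ← Finset.mul_sum] at key
    have : 0 ≤ t * (A + t * (D.lam / 2 * ∑ j : Fin p, d j.succ ^ 2)) := by
      rw [hA]
      linarith
    exact nonneg_of_mul_nonneg_right this ht0
  have hlim : Tendsto (fun t : ℝ => A + t * (D.lam / 2 * ∑ j : Fin p, d j.succ ^ 2)) (𝓝[>] 0) (𝓝 A) := by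
    have : Tendsto (fun t : ℝ => A + t * (D.lam / 2 * ∑ j : Fin p, d j.succ ^ 2)) (𝓝 0)
        (𝓝 (A + 0 * (D.lam / 2 * ∑ j : Fin p, d j.succ ^ 2))) :=
      (by fun_prop : Continuous fun t : ℝ => A + t * (D.lam / 2 * ∑ j : Fin p, d j.succ ^ 2)).tendsto 0
    rw [zero_mul, add_zero] at this
    exact this.mono_left nhdsWithin_le_nhds
  exact ge_of_tendsto hlim hev

theorem Data.mem_init_L (D : Data n p) (f : Fit p) (i : Fin n) :
    i ∈ (D.init f).L ↔ D.resid f i < 0 := by simp [Data.init]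

theorem Data.mem_init_E (D : Data n p) (f : Fit p) (i : Fin n) :
    i ∈ (D.init f).E ↔ D.resid f i = 0 := by simp [Data.init]

theorem Data.mem_init_R (D : Data n p) (f : Fit p) (i : Fin n) :
    i ∈ (D.init f).R ↔ 0 < D.resid f i := by simp [Data.init]

theorem Data.init_th_of_neg (D : Data n p) {f : Fit p} {i : Fin n} (h : D.resid f i < 0) :
    (D.init f).th i = D.tau - 1 := by simp [Data.init, h]

theorem Data.init_th_of_pos (D : Data n p) {f : Fit p} {i : Fin n} (h : 0 < D.resid f i) :
    (D.init f).th i = D.tau := by simp [Data.init, h, h.le]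

/-- The right-hand side of the equation that defines the initial elbow dual variables, before
multiplication by the matrix of elbow covariates. -/
def Data.initTarget (D : Data n p) (f : Fit p) : Fin (p + 1) → ℝ :=
  Fin.cons 0 (fun j => D.lam * f.b j)
    - ((∑ k ∈ (D.init f).L, (D.tau - 1) • D.xt k) + ∑ k ∈ (D.init f).R, D.tau • D.xt k)

/-- The initial elbow dual variables. -/
def Data.initThE (D : Data n p) (f : Fit p) : (D.init f).E → ℝ :=
  D.gramInv (D.init f).E *ᵥ (D.XE (D.init f).E *ᵥ D.initTarget f)

/-- On the elbow the residual is zero, so λyᵢ - λβ₀ is λ xᵢ·β and the algorithm's right-hand side is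
`XE` applied to `initTarget`. -/
theorem Data.init_th_of_eq (D : Data n p) {f : Fit p} {i : Fin n} (h : D.resid f i = 0) :
    (D.init f).th i = extend (D.init f).E (D.initThE f) i := by
  have hE : D.initThE f = D.gramInv (D.init f).E *ᵥ fun i =>
      D.lam * D.y i - D.lam * f.b0 - D.xt i ⬝ᵥ
        ((∑ k ∈ (D.init f).L, (D.tau - 1) • D.xt k) + ∑ k ∈ (D.init f).R, D.tau • D.xt k) := by
    rw [Data.initThE]
    congr 1
    funext i
    have hi := (D.mem_init_E f i).1 i.2
    have h1 : D.xt i ⬝ᵥ (Fin.cons 0 fun j => D.lam * f.b j) = D.lam * (D.x i ⬝ᵥ f.b) := by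
      rw [Data.xt_dotProduct]
      simp only [Fin.cons_zero, Fin.cons_succ, zero_add]
      exact dotProduct_smul D.lam (D.x i) f.b
    change D.xt i ⬝ᵥ D.initTarget f = _
    rw [Data.initTarget, dotProduct_sub, h1]
    rw [Data.resid] at hi
    have : D.y i = f.b0 + D.x i ⬝ᵥ f.b := by linarith
    rw [this]
    ring
  have hL : i ∉ (D.init f).L := fun hi => ((D.mem_init_L f i).1 hi).ne h
  have hR : i ∉ (D.init f).R := fun hi => ((D.mem_init_R f i).1 hi).ne' h
  rw [hE]
  exact (if_neg hL).trans (if_neg hR)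

theorem Data.init_partition (D : Data n p) (f : Fit p) (g : Fin n → ℝ) :
    ∑ i, g i = ∑ i ∈ (D.init f).L, g i + ∑ i ∈ (D.init f).R, g i + ∑ i ∈ (D.init f).E, g i := by
  simp only [Data.init, Finset.sum_filter, ← Finset.sum_add_distrib]
  refine Finset.sum_congr rfl fun i _ => ?_
  rcases lt_trichotomy (D.resid f i) 0 with h | h | h
  · simp [h, h.ne, h.le]
  · simp [h]
  · simp [h, h.ne', h.le]

/-- Off the elbow the directional derivatives are linear and combine with the ridge term into
`initTarget`; only the elbow losses stay nonlinear. -/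
theorem Data.Solves.initTarget_nonneg {D : Data n p} {f : Fit p} (hf : D.Solves 1 f)
    (d : Fin (p + 1) → ℝ) :
    0 ≤ D.initTarget f ⬝ᵥ d + ∑ i ∈ (D.init f).E, checkLoss D.tau (-(D.xt i ⬝ᵥ d)) := by
  have h := hf.deriv_nonneg d
  rw [D.init_partition f] at h
  have hL : ∑ i ∈ (D.init f).L, checkLossDeriv D.tau (D.resid f i) (-(D.xt i ⬝ᵥ d))
      = -((∑ k ∈ (D.init f).L, (D.tau - 1) • D.xt k) ⬝ᵥ d) := by
    rw [sum_dotProduct, ← Finset.sum_neg_distrib]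
    refine Finset.sum_congr rfl fun i hi => ?_
    rw [checkLossDeriv, if_pos ((D.mem_init_L f i).1 hi), smul_dotProduct, smul_eq_mul, mul_neg]
  have hR : ∑ i ∈ (D.init f).R, checkLossDeriv D.tau (D.resid f i) (-(D.xt i ⬝ᵥ d))
      = -((∑ k ∈ (D.init f).R, D.tau • D.xt k) ⬝ᵥ d) := by
    rw [sum_dotProduct, ← Finset.sum_neg_distrib]
    refine Finset.sum_congr rfl fun i hi => ?_
    have := (D.mem_init_R f i).1 hi
    rw [checkLossDeriv, if_neg (not_lt.2 this.le), if_pos this, smul_dotProduct, smul_eq_mul,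
      mul_neg]
  have hE : ∑ i ∈ (D.init f).E, checkLossDeriv D.tau (D.resid f i) (-(D.xt i ⬝ᵥ d))
      = ∑ i ∈ (D.init f).E, checkLoss D.tau (-(D.xt i ⬝ᵥ d)) := by
    refine Finset.sum_congr rfl fun i hi => ?_
    have := (D.mem_init_E f i).1 hi
    rw [checkLossDeriv, this, if_neg (lt_irrefl _), if_neg (lt_irrefl _)]
  have hb : (Fin.cons 0 (fun j => D.lam * f.b j) : Fin (p + 1) → ℝ) ⬝ᵥ d
      = D.lam * ∑ j, f.b j * d j.succ := by
    simp [dotProduct, Fin.sum_univ_succ, Finset.mul_sum, mul_assoc]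
  rw [hL, hR, hE] at h
  rw [Data.initTarget, sub_dotProduct, add_dotProduct, hb]
  linarith

theorem Data.GeneralPosition.init_indep {D : Data n p} (hgp : D.GeneralPosition) (f : Fit p) :
    D.Indep (D.init f).E :=
  hgp.indep f _ fun i hi => (D.mem_init_E f i).1 hi

/-- Let `v` be the component of the target orthogonal to the elbow rows. Along `-v` the elbow
residuals stay fixed, so the directional derivative is `-(v ⬝ᵥ v)`; optimality forces `v = 0`. -/
theorem Data.Solves.initTarget_eq {D : Data n p} {f : Fit p} (hgp : D.GeneralPosition)
    (hf : D.Solves 1 f) : D.initTarget f = (D.XE (D.init f).E)ᵀ *ᵥ D.initThE f := by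
  have hI := hgp.init_indep f
  set X := D.XE (D.init f).E
  set v := D.initTarget f - Xᵀ *ᵥ D.initThE f with hv
  have hXv : X *ᵥ v = 0 := by
    rw [hv, Matrix.mulVec_sub, Matrix.mulVec_mulVec, Data.initThE, Matrix.mulVec_mulVec,
      hI.gram_mul_inv, Matrix.one_mulVec, sub_self]
  have h := hf.initTarget_nonneg (-v)
  have hz : ∑ i ∈ (D.init f).E, checkLoss D.tau (-(D.xt i ⬝ᵥ -v)) = 0 := by
    refine Finset.sum_eq_zero fun i hi => ?_
    have : D.xt i ⬝ᵥ v = 0 := congrFun hXv ⟨i, hi⟩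
    rw [dotProduct_neg, this]
    simp [checkLoss]
  have hvv : D.initTarget f ⬝ᵥ v = v ⬝ᵥ v := by
    have h1 : (Xᵀ *ᵥ D.initThE f) ⬝ᵥ v = 0 := by
      rw [Matrix.mulVec_transpose, ← Matrix.dotProduct_mulVec, hXv, dotProduct_zero]
    conv_rhs => lhs; rw [hv]
    rw [sub_dotProduct, h1, sub_zero]
  rw [hz, add_zero, dotProduct_neg, hvv] at h
  have h0 : 0 ≤ v ⬝ᵥ v := Finset.sum_nonneg fun i _ => mul_self_nonneg _
  exact sub_eq_zero.1 (dotProduct_self_eq_zero.1 (le_antisymm (by linarith) h0))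

/-- The initial dual variables certify the optimality of the initial fit. -/
theorem Data.Solves.init_optimal {D : Data n p} {f : Fit p} (htau0 : 0 < D.tau)
    (htau1 : D.tau < 1) (hgp : D.GeneralPosition) (hf : D.Solves 1 f) :
    D.Optimal 1 f (D.init f).th := by
  have hI := hgp.init_indep f
  have hT := hf.initTarget_eq hgp
  have hw : ∀ i, D.weight 1 i = 1 := fun i => by simp [Data.weight]
  -- The direction `d` below changes the fitted value of elbow case `k` by `c` and of no other elbow
  -- case, which isolates its dual variable. Taking `c = 1` and `c = -1` gives the lower and the
  -- upper bound.
  have htest : ∀ (k : (D.init f).E) (c : ℝ), 0 ≤ c * D.initThE f k + checkLoss D.tau (-c) := by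
    intro k c
    set d := c • ((D.XE (D.init f).E)ᵀ *ᵥ (D.gramInv (D.init f).E *ᵥ Pi.single k 1)) with hd
    have hXd : D.XE (D.init f).E *ᵥ d = c • Pi.single k 1 := by
      rw [hd, Matrix.mulVec_smul, Matrix.mulVec_mulVec, Matrix.mulVec_mulVec, hI.gram_mul_inv,
        Matrix.one_mulVec]
    have h := hf.initTarget_nonneg d
    have h1 : D.initTarget f ⬝ᵥ d = c * D.initThE f k := by
      rw [hT, Matrix.mulVec_transpose, ← Matrix.dotProduct_mulVec, hXd, dotProduct_smul,
        dotProduct_single_one, smul_eq_mul]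
    have h2 : ∑ i ∈ (D.init f).E, checkLoss D.tau (-(D.xt i ⬝ᵥ d)) = checkLoss D.tau (-c) := by
      rw [Finset.sum_eq_single_of_mem k.1 k.2]
      · have : D.xt k ⬝ᵥ d = c :=
          (show D.xt k ⬝ᵥ d = (c • Pi.single k 1 : (D.init f).E → ℝ) k from
            congrFun hXd k).trans (by simp)
        rw [this]
      · intro i hi hik
        have h3 := congrFun hXd ⟨i, hi⟩
        have h4 : (⟨i, hi⟩ : (D.init f).E) ≠ k := fun h => hik (congrArg Subtype.val h)
        have : D.xt i ⬝ᵥ d = 0 :=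
          (show D.xt i ⬝ᵥ d = (c • Pi.single k 1 : (D.init f).E → ℝ) ⟨i, hi⟩ from h3).trans
            (by simp [h4])
        rw [this]
        simp [checkLoss]
    rwa [h1, h2] at h
  have hrange : ∀ i, D.resid f i = 0 →
      D.tau - 1 ≤ (D.init f).th i ∧ (D.init f).th i ≤ D.tau := by
    intro i hi
    have hiE := (D.mem_init_E f i).2 hi
    rw [D.init_th_of_eq hi, extend_of_mem _ hiE]
    have h1 := htest ⟨i, hiE⟩ 1
    have h2 := htest ⟨i, hiE⟩ (-1)
    rw [checkLoss_of_nonpos _ (by norm_num)] at h1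
    rw [checkLoss_of_nonneg _ (by norm_num)] at h2
    constructor <;> linarith
  -- Component 0 is the intercept equation, the others are the coefficient equations.
  have hall : ∀ j, ∑ i, (D.init f).th i * D.xt i j
      = (Fin.cons 0 (fun j => D.lam * f.b j) : Fin (p + 1) → ℝ) j := by
    intro j
    rw [D.init_partition f]
    have hL : ∑ i ∈ (D.init f).L, (D.init f).th i * D.xt i j
        = (∑ k ∈ (D.init f).L, (D.tau - 1) • D.xt k) j := by
      rw [Finset.sum_apply]
      exact Finset.sum_congr rfl fun i hi => by
        rw [D.init_th_of_neg ((D.mem_init_L f i).1 hi), Pi.smul_apply, smul_eq_mul]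
    have hR : ∑ i ∈ (D.init f).R, (D.init f).th i * D.xt i j
        = (∑ k ∈ (D.init f).R, D.tau • D.xt k) j := by
      rw [Finset.sum_apply]
      exact Finset.sum_congr rfl fun i hi => by
        rw [D.init_th_of_pos ((D.mem_init_R f i).1 hi), Pi.smul_apply, smul_eq_mul]
    have hE : ∑ i ∈ (D.init f).E, (D.init f).th i * D.xt i j = D.initTarget f j := by
      rw [hT, Data.XE_transpose_mulVec]
      exact Finset.sum_congr rfl fun i hi => by rw [D.init_th_of_eq ((D.mem_init_E f i).1 hi)]
    rw [hL, hR, hE, Data.initTarget, Pi.sub_apply, Pi.add_apply]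
    ring
  refine ⟨⟨by simpa using hall 0, fun j => by simpa using (hall j.succ).symm⟩, ?_, ?_, ?_, ?_⟩
  · intro i
    rw [hw, one_mul]
    rcases lt_trichotomy (D.resid f i) 0 with h | h | h
    · rw [D.init_th_of_neg h]
    · exact (hrange i h).1
    · rw [D.init_th_of_pos h]; linarith
  · intro i
    rw [hw, one_mul]
    rcases lt_trichotomy (D.resid f i) 0 with h | h | h
    · rw [D.init_th_of_neg h]; linarith
    · exact (hrange i h).2
    · rw [D.init_th_of_pos h]
  · intro i h
    rw [hw, one_mul, D.init_th_of_pos h]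
  · intro i h
    rw [hw, one_mul, D.init_th_of_neg h]


/-! ### One segment of the path -/

/-- The invariant of the loop: the optimality conditions at the current weight, together with the
fact that the cases at the boundary of their range are about to move into its interior. -/
structure Data.Inv (D : Data n p) (s : State n p) : Prop extends D.Stationary s.fit s.th where
  w_pos : 0 < s.w
  star_notMem : D.star ∉ s.E
  cover : ∀ i, i ∈ s.E ∨ i ∈ s.L ∨ i ∈ s.R
  notMem_L : ∀ i ∈ s.E, i ∉ s.L
  notMem_R : ∀ i ∈ s.E, i ∉ s.R
  disjoint : ∀ i ∈ s.L, i ∉ s.R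
  r_eq : ∀ i, s.r i = D.resid s.fit i
  th_off : ∀ i ∉ s.E, s.th i = D.weight s.w i * if i ∈ s.L then D.tau - 1 else D.tau
  r_E : ∀ i ∈ s.E, s.r i = 0
  r_L : ∀ i ∈ s.L, s.r i ≤ 0
  r_R : ∀ i ∈ s.R, 0 ≤ s.r i
  th_ge : ∀ i ∈ s.E, D.tau - 1 ≤ s.th i
  th_le : ∀ i ∈ s.E, s.th i ≤ D.tau
  slope_bot : ∀ i ∈ s.E, s.th i = D.tau - 1 → D.slopeTh s i < 0
  slope_top : ∀ i ∈ s.E, s.th i = D.tau → 0 < D.slopeTh s i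
  slope_L : s.E.Nonempty → ∀ i ∈ s.L, s.r i = 0 → 0 < D.slopeR s i
  slope_R : s.E.Nonempty → ∀ i ∈ s.R, s.r i = 0 → D.slopeR s i < 0

theorem Data.Inv.indep {D : Data n p} {s : State n p} (h : D.Inv s) (hgp : D.GeneralPosition) :
    D.Indep s.E :=
  hgp.indep s.fit s.E fun i hi => by rw [← h.r_eq, h.r_E i hi]

/-- One affine formula for all cases, so that the stationarity equations can be summed without
splitting by set. -/
theorem Data.thAt_eq {D : Data n p} {s : State n p} (h : D.Inv s) (w : ℝ) (i : Fin n) :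
    D.thAt s w i = s.th i
      + (w - s.w) * (D.slopeTh s i + if i = D.star then D.sgn s else 0) := by
  by_cases hi : i ∈ s.E
  · have : i ≠ D.star := fun e => h.star_notMem (e ▸ hi)
    rw [Data.thAt, if_pos hi, if_neg this]
    ring
  · rw [Data.thAt, if_neg hi, h.th_off i hi, D.slopeTh_of_notMem s hi]
    by_cases hs : i = D.star
    · simp only [hs, if_true, Data.weight, Data.sgn]
      ring
    · simp only [hs, if_false, Data.weight]
      ring

theorem Data.Inv.stationary_fitAt {D : Data n p} {s : State n p} (h : D.Inv s)
    (hgp : D.GeneralPosition) (hlam : 0 < D.lam) (hne : s.E.Nonempty) (w : ℝ) :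
    D.Stationary (D.fitAt s w) (D.thAt s w) := by
  have hI := h.indep hgp
  have key : ∀ g : Fin n → ℝ, ∑ i, D.thAt s w i * g i = ∑ i, s.th i * g i
      + (w - s.w) * (∑ i ∈ s.E, D.slopeTh s i * g i + D.sgn s * g D.star) := by
    intro g
    have h1 : ∑ i ∈ s.E, D.slopeTh s i * g i = ∑ i, D.slopeTh s i * g i :=
      Finset.sum_subset (Finset.subset_univ _) fun i _ hi => by
        rw [D.slopeTh_of_notMem s hi, zero_mul]
    have h2 : D.sgn s * g D.star = ∑ i, (if i = D.star then D.sgn s else 0) * g i := by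
      simp [ite_mul]
    rw [h1, h2, ← Finset.sum_add_distrib, Finset.mul_sum, ← Finset.sum_add_distrib]
    exact Finset.sum_congr rfl fun i _ => by rw [D.thAt_eq h]; ring
  refine ⟨?_, fun j => ?_⟩
  · have := key 1
    simp only [Pi.one_apply, mul_one] at this
    rw [this, h.sum_eq, D.sum_slopeTh hI hne]
    ring
  · rw [key fun i => D.x i j, ← h.coef_eq]
    simp only [Data.fitAt]
    field_simp

theorem Data.Inv.rAt_eq {D : Data n p} {s : State n p} (h : D.Inv s) (hgp : D.GeneralPosition)
    (hne : s.E.Nonempty) (w : ℝ) (i : Fin n) : D.rAt s w i = D.resid (D.fitAt s w) i := by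
  have h0 := D.dir_zero (h.indep hgp) hne
  have hb : (D.fitAt s w).b = s.fit.b + ((w - s.w) / D.lam) • fun j => D.dir s j.succ := by
    ext j
    simp only [Data.fitAt, Data.dir, Pi.add_apply, Pi.smul_apply, smul_eq_mul, Data.xt_succ]
    ring
  rw [Data.rAt, h.r_eq, Data.slopeR_eq, Data.xt_dotProduct, h0, Data.resid, Data.resid, hb,
    dotProduct_add, dotProduct_smul]
  simp only [Data.fitAt, smul_eq_mul]
  ring

theorem Data.elbowTime_le_next {D : Data n p} {s : State n p} {q : Fin n × ℝ}
    (hq : q ∈ D.elbowCand s) : (D.elbowTime s q : WithBot ℝ) ≤ D.next s :=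
  (Finset.le_max (Finset.mem_image_of_mem _ hq)).trans (le_max_left _ _)

theorem Data.sideTime_le_next {D : Data n p} {s : State n p} {i : Fin n}
    (hi : i ∈ D.sideCand s) : (D.sideTime s i : WithBot ℝ) ≤ D.next s :=
  (Finset.le_max (Finset.mem_image_of_mem _ hi)).trans (le_max_right _ _)

theorem Data.next_cases (D : Data n p) (s : State n p) :
    D.next s = ⊥ ∨ (∃ q ∈ D.elbowCand s, (D.elbowTime s q : WithBot ℝ) = D.next s) ∨
      ∃ i ∈ D.sideCand s, (D.sideTime s i : WithBot ℝ) = D.next s := by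
  have aux : ∀ S : Finset ℝ, S.max = ⊥ ∨ ∃ a ∈ S, (a : WithBot ℝ) = S.max := by
    intro S
    rcases S.eq_empty_or_nonempty with rfl | hS
    · exact Or.inl rfl
    · obtain ⟨a, ha⟩ := Finset.max_of_nonempty hS
      exact Or.inr ⟨a, Finset.mem_of_max ha, ha.symm⟩
  rcases max_choice (D.cand1 s) (D.cand2 s) with h | h
  · rw [Data.next, h]
    rcases aux ((D.elbowCand s).image (D.elbowTime s)) with h1 | ⟨a, ha, h1⟩
    · exact Or.inl h1
    · obtain ⟨q, hq, rfl⟩ := Finset.mem_image.1 ha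
      exact Or.inr (Or.inl ⟨q, hq, h1⟩)
  · rw [Data.next, h]
    rcases aux ((D.sideCand s).image (D.sideTime s)) with h1 | ⟨a, ha, h1⟩
    · exact Or.inl h1
    · obtain ⟨i, hi, rfl⟩ := Finset.mem_image.1 ha
      exact Or.inr (Or.inr ⟨i, hi, h1⟩)

theorem Data.mem_elbowCand {D : Data n p} {s : State n p} {i : Fin n} {c : ℝ} :
    (i, c) ∈ D.elbowCand s ↔ (i ∈ s.E ∧ (c = D.tau ∨ c = D.tau - 1)) ∧
      -s.w ≤ (c - s.th i) / D.slopeTh s i ∧ (c - s.th i) / D.slopeTh s i < 0 := by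
  simp [Data.elbowCand]

theorem Data.mem_sideCand {D : Data n p} {s : State n p} {i : Fin n} :
    i ∈ D.sideCand s ↔ (i ∈ s.L ∨ i ∈ s.R) ∧
      0 < D.lam * s.r i / D.slopeR s i ∧ D.lam * s.r i / D.slopeR s i ≤ s.w := by
  simp [Data.sideCand]

/-- The next breakpoint. -/
def Data.nextW (D : Data n p) (s : State n p) : ℝ := (D.next s).unbotD 0

theorem Data.next_eq_of_pos {D : Data n p} {s : State n p} (h : 0 < D.nextW s) :
    D.next s = (D.nextW s : WithBot ℝ) := by
  unfold Data.nextW at *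
  cases hx : D.next s with
  | bot => simp [hx] at h
  | coe a => simp

theorem Data.le_nextW {D : Data n p} {s : State n p} {a : ℝ} (h : (a : WithBot ℝ) ≤ D.next s) :
    a ≤ D.nextW s := by
  unfold Data.nextW
  cases hx : D.next s with
  | bot => simp [hx] at h
  | coe b => simpa [hx] using h

theorem Data.nextW_mem {D : Data n p} {s : State n p} (hw : 0 < s.w) :
    0 ≤ D.nextW s ∧ D.nextW s < s.w := by
  rcases D.next_cases s with h | ⟨⟨i, c⟩, hq, h⟩ | ⟨i, hi, h⟩
  · simp [Data.nextW, h, hw]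
  · rw [Data.nextW, ← h, WithBot.unbotD_coe, Data.elbowTime]
    obtain ⟨-, h1, h2⟩ := Data.mem_elbowCand.1 hq
    constructor <;> simp only <;> linarith
  · rw [Data.nextW, ← h, WithBot.unbotD_coe, Data.sideTime]
    obtain ⟨-, h1, h2⟩ := Data.mem_sideCand.1 hi
    constructor <;> linarith

section Segment

variable {D : Data n p} {s : State n p}

/-- Such a crossing would be a candidate at a weight above `w`, although `nextW` bounds all
candidates. -/
theorem Data.elbow_no_crossing {w : ℝ} (hw0 : 0 ≤ w) (hw : D.nextW s ≤ w)
    {i : Fin n} (hi : i ∈ s.E) {c : ℝ} (hc : c = D.tau ∨ c = D.tau - 1)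
    (h1 : w - s.w < (c - s.th i) / D.slopeTh s i) (h2 : (c - s.th i) / D.slopeTh s i < 0) :
    False := by
  have hq : (i, c) ∈ D.elbowCand s := Data.mem_elbowCand.2 ⟨⟨hi, hc⟩, by linarith, h2⟩
  have := D.le_nextW (D.elbowTime_le_next hq)
  rw [Data.elbowTime] at this
  simp only at this
  linarith

theorem Data.side_no_crossing {w : ℝ} (hw0 : 0 ≤ w) (hw : D.nextW s ≤ w)
    {i : Fin n} (hi : i ∈ s.L ∨ i ∈ s.R)
    (h1 : 0 < D.lam * s.r i / D.slopeR s i) (h2 : D.lam * s.r i / D.slopeR s i < s.w - w) :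
    False := by
  have hq : i ∈ D.sideCand s := Data.mem_sideCand.2 ⟨hi, h1, by linarith⟩
  have := D.le_nextW (D.sideTime_le_next hq)
  rw [Data.sideTime] at this
  linarith

/-- An affine function that ends above τ either crosses τ inside the segment, which
`elbow_no_crossing` excludes, or starts at τ and moves out. The latter contradicts `slope_top`: the
weight decreases, so a positive slope lowers θ. -/
theorem Data.Inv.thAt_le (h : D.Inv s) {w : ℝ} (hw0 : 0 ≤ w) (hw : D.nextW s ≤ w) (hws : w ≤ s.w)
    {i : Fin n} (hi : i ∈ s.E) : D.thAt s w i ≤ D.tau := by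
  rw [Data.thAt, if_pos hi]
  by_contra! hlt
  have hle := h.th_le i hi
  have hne : s.th i ≠ D.tau := fun e => by
    have := mul_nonpos_of_nonneg_of_nonpos (h.slope_top i hi e).le (sub_nonpos.2 hws)
    linarith
  have hneg : D.slopeTh s i < 0 := by
    by_contra! h0
    have := mul_nonpos_of_nonneg_of_nonpos h0 (sub_nonpos.2 hws)
    linarith
  have hlt' : s.th i < D.tau := lt_of_le_of_ne hle hne
  exact D.elbow_no_crossing hw0 hw hi (Or.inl rfl)
    (by rw [lt_div_iff_of_neg hneg]; linarith) (div_neg_of_pos_of_neg (by linarith) hneg)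

theorem Data.Inv.le_thAt (h : D.Inv s) {w : ℝ} (hw0 : 0 ≤ w) (hw : D.nextW s ≤ w) (hws : w ≤ s.w)
    {i : Fin n} (hi : i ∈ s.E) : D.tau - 1 ≤ D.thAt s w i := by
  rw [Data.thAt, if_pos hi]
  by_contra! hlt
  have hle := h.th_ge i hi
  have hne : s.th i ≠ D.tau - 1 := fun e => by
    have := mul_nonneg_of_nonpos_of_nonpos (h.slope_bot i hi e).le (sub_nonpos.2 hws)
    linarith
  have hpos : 0 < D.slopeTh s i := by
    by_contra! h0
    have := mul_nonneg_of_nonpos_of_nonpos h0 (sub_nonpos.2 hws)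
    linarith
  have hlt' : D.tau - 1 < s.th i := lt_of_le_of_ne hle hne.symm
  exact D.elbow_no_crossing hw0 hw hi (Or.inr rfl)
    (by rw [lt_div_iff₀ hpos]; linarith) (div_neg_of_neg_of_pos (by linarith) hpos)

theorem Data.Inv.rAt_nonneg (h : D.Inv s) (hlam : 0 < D.lam) (hne : s.E.Nonempty) {w : ℝ}
    (hw0 : 0 ≤ w) (hw : D.nextW s ≤ w) (hws : w ≤ s.w) {i : Fin n} (hi : i ∈ s.R) :
    0 ≤ D.rAt s w i := by
  by_contra! hlt
  have hlt' : D.lam * s.r i + D.slopeR s i * (w - s.w) < 0 := by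
    have := mul_neg_of_pos_of_neg hlam hlt
    rw [Data.rAt, mul_add, mul_div_cancel₀ _ hlam.ne'] at this
    exact this
  have hr := mul_nonneg hlam.le (h.r_R i hi)
  have hpos : 0 < D.slopeR s i := by
    by_contra! h0
    have := mul_nonneg_of_nonpos_of_nonpos h0 (sub_nonpos.2 hws)
    linarith
  have hr0 : s.r i ≠ 0 := fun e => (h.slope_R hne i hi e).not_gt hpos
  have hr' := mul_pos hlam (lt_of_le_of_ne (h.r_R i hi) hr0.symm)
  exact D.side_no_crossing hw0 hw (Or.inr hi) (div_pos hr' hpos)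
    (by rw [div_lt_iff₀ hpos]; linarith)

theorem Data.Inv.rAt_nonpos (h : D.Inv s) (hlam : 0 < D.lam) (hne : s.E.Nonempty) {w : ℝ}
    (hw0 : 0 ≤ w) (hw : D.nextW s ≤ w) (hws : w ≤ s.w) {i : Fin n} (hi : i ∈ s.L) :
    D.rAt s w i ≤ 0 := by
  by_contra! hlt
  have hlt' : 0 < D.lam * s.r i + D.slopeR s i * (w - s.w) := by
    have := mul_pos hlam hlt
    rw [Data.rAt, mul_add, mul_div_cancel₀ _ hlam.ne'] at this
    exact this
  have hr := mul_nonpos_of_nonneg_of_nonpos hlam.le (h.r_L i hi)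
  have hneg : D.slopeR s i < 0 := by
    by_contra! h0
    have := mul_nonpos_of_nonneg_of_nonpos h0 (sub_nonpos.2 hws)
    linarith
  have hr0 : s.r i ≠ 0 := fun e => (h.slope_L hne i hi e).not_gt hneg
  have hr' := mul_neg_of_pos_of_neg hlam (lt_of_le_of_ne (h.r_L i hi) hr0)
  exact D.side_no_crossing hw0 hw (Or.inl hi) (div_pos_of_neg_of_neg hr' hneg)
    (by rw [div_lt_iff_of_neg hneg]; linarith)

theorem Data.Inv.rAt_elbow (h : D.Inv s) (hgp : D.GeneralPosition) (w : ℝ) {i : Fin n}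
    (hi : i ∈ s.E) : D.rAt s w i = 0 := by
  rw [Data.rAt, h.r_E i hi, D.slopeR_elbow (h.indep hgp) i hi]
  simp

/-- Between two breakpoints the path satisfies the optimality conditions. -/
theorem Data.Inv.optimal_fitAt (h : D.Inv s) (hgp : D.GeneralPosition) (hlam : 0 < D.lam)
    (htau0 : 0 < D.tau) (htau1 : D.tau < 1) (hne : s.E.Nonempty) {w : ℝ} (hw0 : 0 ≤ w)
    (hw : D.nextW s ≤ w) (hws : w ≤ s.w) : D.Optimal w (D.fitAt s w) (D.thAt s w) := by
  have hwt : ∀ i, 0 ≤ D.weight w i := fun i => by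
    unfold Data.weight; split_ifs <;> linarith
  have hone : ∀ i ∈ s.E, D.weight w i = 1 := fun i hi =>
    if_neg (show i ≠ D.star from fun e => h.star_notMem (e ▸ hi))
  have hL : ∀ i ∈ s.L, D.thAt s w i = D.weight w i * (D.tau - 1) := fun i hi => by
    rw [Data.thAt, if_neg fun hE => h.notMem_L i hE hi, if_pos hi, Data.weight]
  have hR : ∀ i ∈ s.R, D.thAt s w i = D.weight w i * D.tau := fun i hi => by
    rw [Data.thAt, if_neg fun hE => h.notMem_R i hE hi, if_neg fun hL => h.disjoint i hL hi,
      Data.weight]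
  refine ⟨h.stationary_fitAt hgp hlam hne w, fun i => ?_, fun i => ?_, fun i hi => ?_,
    fun i hi => ?_⟩
  · rcases h.cover i with hE | hE | hE
    · rw [hone i hE, one_mul]; exact h.le_thAt hw0 hw hws hE
    · rw [hL i hE]
    · rw [hR i hE]; exact mul_le_mul_of_nonneg_left (by linarith) (hwt i)
  · rcases h.cover i with hE | hE | hE
    · rw [hone i hE, one_mul]; exact h.thAt_le hw0 hw hws hE
    · rw [hL i hE]; exact mul_le_mul_of_nonneg_left (by linarith) (hwt i)
    · rw [hR i hE]
  · rw [← h.rAt_eq hgp hne] at hi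
    rcases h.cover i with hE | hE | hE
    · exact absurd (h.rAt_elbow hgp w hE) hi.ne'
    · exact absurd (h.rAt_nonpos hlam hne hw0 hw hws hE) (not_le.2 hi)
    · exact hR i hE
  · rw [← h.rAt_eq hgp hne] at hi
    rcases h.cover i with hE | hE | hE
    · exact absurd (h.rAt_elbow hgp w hE) hi.ne
    · exact hL i hE
    · exact absurd (h.rAt_nonneg hlam hne hw0 hw hws hE) (not_le.2 hi)

/-! ### Passing a breakpoint -/

/-- Together with uniqueness this puts every other elbow case strictly inside its range at the
breakpoint. The slope is nonzero because a motionless case at a boundary would contradict the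
invariant at `s`. -/
theorem Data.Inv.hitsElbow (h : D.Inv s) (hpos : 0 < D.nextW s) {i : Fin n} (hi : i ∈ s.E)
    {c : ℝ} (hc : c = D.tau ∨ c = D.tau - 1) (he : D.thAt s (D.nextW s) i = c) :
    D.HitsElbow s i := by
  have hlt := (D.nextW_mem h.w_pos).2
  rw [Data.thAt, if_pos hi] at he
  have hne : D.slopeTh s i ≠ 0 := fun h0 => by
    rw [h0, zero_mul, add_zero] at he
    rcases hc with hc | hc
    · exact (h.slope_top i hi (he.trans hc)).ne' h0
    · exact (h.slope_bot i hi (he.trans hc)).ne h0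
  have hq : (c - s.th i) / D.slopeTh s i = D.nextW s - s.w := by
    rw [div_eq_iff hne]; linarith
  refine ⟨c, Data.mem_elbowCand.2 ⟨⟨hi, hc⟩, by linarith, by linarith⟩, ?_⟩
  rw [D.next_eq_of_pos hpos, Data.elbowTime]
  simp only [hq]
  congr 1
  ring

theorem Data.Inv.hitsSide (h : D.Inv s) (hlam : 0 < D.lam) (hne : s.E.Nonempty)
    (hpos : 0 < D.nextW s) {i : Fin n} (hi : i ∈ s.L ∨ i ∈ s.R)
    (he : D.rAt s (D.nextW s) i = 0) : D.HitsSide s i := by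
  have hlt := (D.nextW_mem h.w_pos).2
  have he' : D.lam * s.r i + D.slopeR s i * (D.nextW s - s.w) = 0 := by
    rw [Data.rAt] at he
    have := congrArg (D.lam * ·) he
    simp only [mul_add, mul_div_cancel₀ _ hlam.ne', mul_zero] at this
    exact this
  have hn : D.slopeR s i ≠ 0 := fun h0 => by
    rw [h0, zero_mul, add_zero] at he'
    have hr := (mul_eq_zero.1 he').resolve_left hlam.ne'
    rcases hi with hi | hi
    · exact (h.slope_L hne i hi hr).ne' h0
    · exact (h.slope_R hne i hi hr).ne h0
  have hq : D.lam * s.r i / D.slopeR s i = s.w - D.nextW s := by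
    rw [div_eq_iff hn]; linarith
  refine ⟨Data.mem_sideCand.2 ⟨hi, by linarith, by linarith⟩, ?_⟩
  rw [D.next_eq_of_pos hpos, Data.sideTime, hq]
  congr 1
  ring

theorem Data.HitsElbow.spec (h : D.Inv s) {i : Fin n} (hi : D.HitsElbow s i) :
    i ∈ s.E ∧ ((D.thAt s (D.nextW s) i = D.tau ∧ D.slopeTh s i < 0) ∨
      (D.thAt s (D.nextW s) i = D.tau - 1 ∧ 0 < D.slopeTh s i)) := by
  obtain ⟨c, hq, ht⟩ := hi
  obtain ⟨⟨hE, hc⟩, -, h2⟩ := Data.mem_elbowCand.1 hq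
  have hW : D.nextW s = (c - s.th i) / D.slopeTh s i + s.w := by
    rw [Data.nextW, ← ht, WithBot.unbotD_coe, Data.elbowTime]
  -- A zero slope makes the quotient `0`, which fails the strict inequality for candidates.
  have hne : D.slopeTh s i ≠ 0 := fun h0 => by simp [h0] at h2
  have he : D.thAt s (D.nextW s) i = c := by
    rw [Data.thAt, if_pos hE, hW]
    field_simp
    ring
  refine ⟨hE, ?_⟩
  rcases hc with rfl | rfl
  · refine Or.inl ⟨he, ?_⟩
    by_contra! h0
    exact h2.not_ge (div_nonneg (by linarith [h.th_le i hE]) h0)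
  · refine Or.inr ⟨he, ?_⟩
    by_contra! h0
    exact h2.not_ge (div_nonneg_of_nonpos (by linarith [h.th_ge i hE]) h0)

theorem Data.HitsSide.spec (h : D.Inv s) (hlam : 0 < D.lam) {i : Fin n} (hi : D.HitsSide s i) :
    D.rAt s (D.nextW s) i = 0 ∧
      ((i ∈ s.L ∧ D.slopeR s i < 0) ∨ (i ∈ s.R ∧ 0 < D.slopeR s i)) := by
  obtain ⟨hq, ht⟩ := hi
  obtain ⟨hi, h1, -⟩ := Data.mem_sideCand.1 hq
  have hW : D.nextW s = -(D.lam * s.r i / D.slopeR s i) + s.w := by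
    rw [Data.nextW, ← ht, WithBot.unbotD_coe, Data.sideTime]
  have hne : D.slopeR s i ≠ 0 := fun h0 => by simp [h0] at h1
  refine ⟨?_, ?_⟩
  · rw [Data.rAt, hW]
    field_simp
    ring
  · rcases hi with hi | hi
    · refine Or.inl ⟨hi, ?_⟩
      by_contra! h0
      exact h1.not_ge (div_nonpos_of_nonpos_of_nonneg
        (mul_nonpos_of_nonneg_of_nonpos hlam.le (h.r_L i hi)) h0)
    · refine Or.inr ⟨hi, ?_⟩
      by_contra! h0
      exact h1.not_ge (div_nonpos_of_nonneg_of_nonpos (mul_nonneg hlam.le (h.r_R i hi)) h0)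

/-- The distinguished case never returns to the elbow set. -/
theorem Data.HitsSide.ne_star (h : D.Inv s) (hgp : D.GeneralPosition) (hlam : 0 < D.lam)
    (htau0 : 0 < D.tau) (htau1 : D.tau < 1) (hne : s.E.Nonempty) {i : Fin n}
    (hi : D.HitsSide s i) : i ≠ D.star := by
  rintro rfl
  have hs := D.sgn_mul_slopeR_star_nonpos (h.indep hgp) hne
  rcases (Data.HitsSide.spec h hlam hi).2 with ⟨hL, hr⟩ | ⟨hR, hr⟩
  · rw [Data.sgn, if_pos hL] at hs
    have := mul_pos_of_neg_of_neg (show D.tau - 1 < 0 by linarith) hr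
    linarith
  · rw [Data.sgn, if_neg fun hL => h.disjoint _ hL hR] at hs
    have := mul_pos htau0 hr
    linarith

/-- The invariant is passed on to a state in which a single case `i` has changed sets, if the
position and the motion of `i` are consistent. -/
theorem Data.Inv.transfer (h : D.Inv s) (hgp : D.GeneralPosition) (hlam : 0 < D.lam)
    (hne : s.E.Nonempty) (hpos : 0 < D.nextW s) {t : State n p} {i : Fin n}
    (htw : t.w = D.nextW s) (htf : t.fit = D.fitAt s (D.nextW s))
    (htt : t.th = D.thAt s (D.nextW s)) (htr : t.r = D.rAt s (D.nextW s))
    (hE : ∀ k, k ≠ i → (k ∈ t.E ↔ k ∈ s.E)) (hL : ∀ k, k ≠ i → (k ∈ t.L ↔ k ∈ s.L))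
    (hR : ∀ k, k ≠ i → (k ∈ t.R ↔ k ∈ s.R)) (hstar : i ≠ D.star)
    (hhit : ∀ k, k ≠ i → ¬ (D.HitsElbow s k ∨ D.HitsSide s k))
    (hi : (i ∈ t.E ∧ i ∉ t.L ∧ i ∉ t.R ∧ ((t.th i = D.tau ∧ 0 < D.slopeTh t i) ∨
          (t.th i = D.tau - 1 ∧ D.slopeTh t i < 0))) ∨
      (i ∉ t.E ∧ i ∈ t.L ∧ i ∉ t.R ∧ t.th i = D.tau - 1 ∧ (t.E.Nonempty → 0 < D.slopeR t i)) ∨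
      (i ∉ t.E ∧ i ∉ t.L ∧ i ∈ t.R ∧ t.th i = D.tau ∧ (t.E.Nonempty → D.slopeR t i < 0)))
    (hri : t.r i = 0) : D.Inv t := by
  have hlt := (D.nextW_mem h.w_pos).2
  have hwi : D.weight t.w i = 1 := if_neg hstar
  -- Hence the slope clauses of the invariant are vacuous for every elbow case but `i`; `hLR` does
  -- the same off the elbow.
  have hEth : ∀ k, k ≠ i → k ∈ s.E → t.th k ≠ D.tau ∧ t.th k ≠ D.tau - 1 := by
    intro k hk hks
    rw [htt]
    exact ⟨fun e => hhit k hk (Or.inl (h.hitsElbow hpos hks (Or.inl rfl) e)),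
      fun e => hhit k hk (Or.inl (h.hitsElbow hpos hks (Or.inr rfl) e))⟩
  have hLR : ∀ k, k ≠ i → (k ∈ s.L ∨ k ∈ s.R) → t.r k ≠ 0 := by
    intro k hk hks
    rw [htr]
    exact fun e => hhit k hk (Or.inr (h.hitsSide hlam hne hpos hks e))
  exact
  { toStationary := by rw [htf, htt]; exact h.stationary_fitAt hgp hlam hne _
    w_pos := htw ▸ hpos
    star_notMem := by rw [hE _ hstar.symm]; exact h.star_notMem
    cover := fun k => by
      by_cases hk : k = i
      · subst hk; tauto
      · rw [hE k hk, hL k hk, hR k hk]; exact h.cover k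
    notMem_L := fun k => by
      by_cases hk : k = i
      · subst hk; tauto
      · rw [hE k hk, hL k hk]; exact h.notMem_L k
    notMem_R := fun k => by
      by_cases hk : k = i
      · subst hk; tauto
      · rw [hE k hk, hR k hk]; exact h.notMem_R k
    disjoint := fun k => by
      by_cases hk : k = i
      · subst hk; tauto
      · rw [hL k hk, hR k hk]; exact h.disjoint k
    r_eq := fun k => by rw [htr, htf]; exact h.rAt_eq hgp hne _ _
    th_off := fun k hkE => by
      by_cases hk : k = i
      · subst hk
        rw [hwi, one_mul]
        rcases hi with hi | hi | hi
        · exact absurd hi.1 hkE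
        · rw [if_pos hi.2.1, hi.2.2.2.1]
        · rw [if_neg hi.2.1, hi.2.2.2.1]
      · rw [hE k hk] at hkE
        rw [htt, htw, Data.thAt, if_neg hkE, Data.weight]
        congr 1
        simp only [hL k hk]
    r_E := fun k hkE => by
      by_cases hk : k = i
      · rw [hk, hri]
      · rw [htr]; exact h.rAt_elbow hgp _ ((hE k hk).1 hkE)
    r_L := fun k hkL => by
      by_cases hk : k = i
      · rw [hk, hri]
      · rw [htr]; exact h.rAt_nonpos hlam hne hpos.le le_rfl hlt.le ((hL k hk).1 hkL)
    r_R := fun k hkR => by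
      by_cases hk : k = i
      · rw [hk, hri]
      · rw [htr]; exact h.rAt_nonneg hlam hne hpos.le le_rfl hlt.le ((hR k hk).1 hkR)
    th_ge := fun k hkE => by
      by_cases hk : k = i
      · subst hk
        rcases hi with ⟨-, -, -, hi | hi⟩ | hi | hi
        · linarith
        · linarith
        · exact absurd hkE hi.1
        · exact absurd hkE hi.1
      · rw [htt]; exact h.le_thAt hpos.le le_rfl hlt.le ((hE k hk).1 hkE)
    th_le := fun k hkE => by
      by_cases hk : k = i
      · subst hk
        rcases hi with ⟨-, -, -, hi | hi⟩ | hi | hi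
        · linarith
        · linarith
        · exact absurd hkE hi.1
        · exact absurd hkE hi.1
      · rw [htt]; exact h.thAt_le hpos.le le_rfl hlt.le ((hE k hk).1 hkE)
    slope_bot := fun k hkE e => by
      by_cases hk : k = i
      · subst hk
        rcases hi with ⟨-, -, -, hi | hi⟩ | hi | hi
        · linarith
        · exact hi.2
        · exact absurd hkE hi.1
        · exact absurd hkE hi.1
      · exact absurd e (hEth k hk ((hE k hk).1 hkE)).2
    slope_top := fun k hkE e => by
      by_cases hk : k = i
      · subst hk
        rcases hi with ⟨-, -, -, hi | hi⟩ | hi | hi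
        · exact hi.2
        · linarith
        · exact absurd hkE hi.1
        · exact absurd hkE hi.1
      · exact absurd e (hEth k hk ((hE k hk).1 hkE)).1
    slope_L := fun hn k hkL e => by
      by_cases hk : k = i
      · subst hk
        rcases hi with hi | hi | hi
        · exact absurd hkL hi.2.1
        · exact hi.2.2.2.2 hn
        · exact absurd hkL hi.2.1
      · exact absurd e (hLR k hk (Or.inl ((hL k hk).1 hkL)))
    slope_R := fun hn k hkR e => by
      by_cases hk : k = i
      · subst hk
        rcases hi with hi | hi | hi
        · exact absurd hkR hi.2.2.1
        · exact absurd hkR hi.2.2.1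
        · exact hi.2.2.2.2 hn
      · exact absurd e (hLR k hk (Or.inr ((hR k hk).1 hkR))) }

theorem Data.loopStep_w : (D.loopStep s).w = D.nextW s := by
  unfold Data.loopStep
  simp only
  split_ifs <;> rfl

theorem Data.loopStep_cases : (∃ i, D.HitsElbow s i ∧
      D.loopStep s = if D.thAt s (D.nextW s) i = D.tau then
        ⟨D.nextW s, D.fitAt s (D.nextW s), D.thAt s (D.nextW s), D.rAt s (D.nextW s),
          s.L, s.E \ {i}, s.R ∪ {i}⟩
      else ⟨D.nextW s, D.fitAt s (D.nextW s), D.thAt s (D.nextW s), D.rAt s (D.nextW s),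
          s.L ∪ {i}, s.E \ {i}, s.R⟩) ∨
    (∃ i, D.HitsSide s i ∧ D.loopStep s =
        ⟨D.nextW s, D.fitAt s (D.nextW s), D.thAt s (D.nextW s), D.rAt s (D.nextW s),
          s.L \ {i}, s.E ∪ {i}, s.R \ {i}⟩) ∨
    ((¬ ∃ i, D.HitsElbow s i) ∧ ¬ ∃ i, D.HitsSide s i) := by
  by_cases h1 : ∃ i, D.HitsElbow s i
  · refine Or.inl ⟨h1.choose, h1.choose_spec, ?_⟩
    unfold Data.loopStep
    simp only
    rw [dif_pos h1]
    rfl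
  · by_cases h2 : ∃ i, D.HitsSide s i
    · refine Or.inr (Or.inl ⟨h2.choose, h2.choose_spec, ?_⟩)
      unfold Data.loopStep
      simp only
      rw [dif_neg h1, dif_pos h2]
      rfl
    · exact Or.inr (Or.inr ⟨h1, h2⟩)

/-- The invariant is passed on by the loop. -/
theorem Data.Inv.loopStep (h : D.Inv s) (hgp : D.GeneralPosition) (hlam : 0 < D.lam)
    (htau0 : 0 < D.tau) (htau1 : D.tau < 1) (hne : s.E.Nonempty) (hpos : 0 < D.nextW s)
    (huniq : ∃! i, D.HitsElbow s i ∨ D.HitsSide s i) : D.Inv (D.loopStep s) := by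
  have hhit : ∀ i, (D.HitsElbow s i ∨ D.HitsSide s i) →
      ∀ k, k ≠ i → ¬ (D.HitsElbow s k ∨ D.HitsSide s k) :=
    fun i hi k hk hk' => hk (huniq.unique hk' hi)
  rcases D.loopStep_cases (s := s) with ⟨i, hi, ht⟩ | ⟨i, hi, ht⟩ | ⟨h1, h2⟩
  · obtain ⟨hE, hth⟩ := Data.HitsElbow.spec h hi
    have hstar : i ≠ D.star := fun e => h.star_notMem (e ▸ hE)
    have hr := h.rAt_elbow hgp (D.nextW s) hE
    -- The exchange lemma with the old state as the one with the larger elbow set. If the new elbow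
    -- set is empty, the residual-slope clauses of the invariant ask for nothing.
    have hex : ∀ t : State n p, t.E = s.E \ {i} → D.sgn t = D.sgn s → t.E.Nonempty →
        0 < D.slopeTh s i * D.slopeR t i := by
      intro t htE hts hn
      refine (D.slopes_exchange (s := t) (t := s) (by simp [htE]) ?_ (h.indep hgp) hn
        hts.symm).resolve_right fun h0 => ?_
      · ext k
        by_cases hk : k = i <;> simp [htE, hk, hE]
      · rcases hth with hth | hth
        · exact hth.2.ne h0.1
        · exact hth.2.ne' h0.1
    rcases hth with ⟨hth, hsl⟩ | ⟨hth, hsl⟩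
    · rw [if_pos hth] at ht
      have hx := hex (D.loopStep s) (by rw [ht]) (by rw [ht]; rfl)
      rw [ht] at hx ⊢
      refine h.transfer hgp hlam hne hpos rfl rfl rfl rfl (i := i) ?_ ?_ ?_ hstar
        (hhit i (Or.inl hi)) (Or.inr (Or.inr ⟨?_, ?_, ?_, hth, fun hn => ?_⟩)) hr
      · intro k hk; simp [hk]
      · intro k hk; simp
      · intro k hk; simp [hk]
      · simp
      · exact h.notMem_L i hE
      · simp
      · exact neg_of_mul_pos_right (hx hn) hsl.le
    · have hnt : ¬ D.thAt s (D.nextW s) i = D.tau := by rw [hth]; linarith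
      rw [if_neg hnt] at ht
      have hx := hex (D.loopStep s) (by rw [ht]) (by
        rw [ht]; simp [Data.sgn, hstar.symm])
      rw [ht] at hx ⊢
      refine h.transfer hgp hlam hne hpos rfl rfl rfl rfl (i := i) ?_ ?_ ?_ hstar
        (hhit i (Or.inl hi)) (Or.inr (Or.inl ⟨?_, ?_, ?_, hth, fun hn => ?_⟩)) hr
      · intro k hk; simp [hk]
      · intro k hk; simp [hk]
      · intro k hk; simp
      · simp
      · simp
      · exact h.notMem_R i hE
      · exact (pos_iff_pos_of_mul_pos (hx hn)).1 hsl
  · obtain ⟨hr, hside⟩ := Data.HitsSide.spec h hlam hi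
    have hstar := Data.HitsSide.ne_star h hgp hlam htau0 htau1 hne hi
    have hiE : i ∉ s.E := fun hE => by
      rcases hside with hs | hs
      · exact h.notMem_L i hE hs.1
      · exact h.notMem_R i hE hs.1
    have htE : (D.loopStep s).E = insert i s.E := by
      rw [ht]; ext k; simp
    have hI : D.Indep (D.loopStep s).E := by
      refine hgp.indep (D.fitAt s (D.nextW s)) _ fun k hk => ?_
      rw [← h.rAt_eq hgp hne]
      rw [htE] at hk
      rcases Finset.mem_insert.1 hk with rfl | hk
      · exact hr
      · exact h.rAt_elbow hgp _ hk
    have hx := (D.slopes_exchange (s := s) (t := D.loopStep s) hiE htE hI hne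
      (by rw [ht]; simp [Data.sgn, hstar.symm])).resolve_right fun h0 => by
        rcases hside with hs | hs
        · exact hs.2.ne h0.2
        · exact hs.2.ne' h0.2
    have hth : D.thAt s (D.nextW s) i = if i ∈ s.L then D.tau - 1 else D.tau := by
      rw [Data.thAt, if_neg hiE, if_neg hstar, one_mul]
    rw [ht] at hx ⊢
    refine h.transfer hgp hlam hne hpos rfl rfl rfl rfl (i := i) ?_ ?_ ?_ hstar
      (hhit i (Or.inr hi)) (Or.inl ⟨?_, ?_, ?_, ?_⟩) hr
    · intro k hk; simp [hk]
    · intro k hk; simp [hk]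
    · intro k hk; simp [hk]
    · simp
    · simp
    · simp
    · rcases hside with ⟨hL, hs⟩ | ⟨hR, hs⟩
      · rw [if_pos hL] at hth
        exact Or.inr ⟨hth, neg_of_mul_pos_left hx hs.le⟩
      · rw [if_neg fun hL => h.disjoint i hL hR] at hth
        exact Or.inl ⟨hth, (pos_iff_pos_of_mul_pos hx).2 hs⟩
  · obtain ⟨i, hi, -⟩ := huniq
    exact (hi.elim (fun h => h1 ⟨i, h⟩) fun h => h2 ⟨i, h⟩).elim

end Segment


/-! ### The start of the path -/

section Start

variable {D : Data n p} {f : Fit p}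

theorem Data.Solves.inv_init (hf : D.Solves 1 f) (hgp : D.GeneralPosition) (htau0 : 0 < D.tau)
    (htau1 : D.tau < 1)
    (hstart : ∀ i ∈ (D.init f).E, i ≠ D.star →
      D.tau - 1 < (D.init f).th i ∧ (D.init f).th i < D.tau)
    (hstar : D.star ∉ (D.init f).E) : D.Inv (D.init f) := by
  have hO := hf.init_optimal htau0 htau1 hgp
  have hw : ∀ i, D.weight (D.init f).w i = 1 := fun i => by simp [Data.weight, Data.init]
  have hs : ∀ i ∈ (D.init f).E, D.tau - 1 < (D.init f).th i ∧ (D.init f).th i < D.tau :=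
    fun i hi => hstart i hi fun e => hstar (e ▸ hi)
  have hr : ∀ i, (D.init f).r i = D.resid f i := fun i => rfl
  exact
  { toStationary := hO.toStationary
    w_pos := one_pos
    star_notMem := hstar
    cover := fun i => by
      rw [D.mem_init_L, D.mem_init_E, D.mem_init_R]
      rcases lt_trichotomy (D.resid f i) 0 with h | h | h <;> tauto
    notMem_L := fun i => by rw [D.mem_init_L, D.mem_init_E]; exact fun h h' => h'.ne h
    notMem_R := fun i => by rw [D.mem_init_R, D.mem_init_E]; exact fun h h' => h'.ne' h
    disjoint := fun i => by rw [D.mem_init_R, D.mem_init_L]; exact fun h h' => h.not_gt h'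
    r_eq := hr
    th_off := fun i hi => by
      rw [hw, one_mul]
      rw [D.mem_init_E] at hi
      rcases lt_or_gt_of_ne hi with h | h
      · rw [D.init_th_of_neg h, if_pos ((D.mem_init_L f i).2 h)]
      · rw [D.init_th_of_pos h, if_neg fun h' => h.not_gt ((D.mem_init_L f i).1 h')]
    r_E := fun i hi => (D.mem_init_E f i).1 hi
    r_L := fun i hi => ((D.mem_init_L f i).1 hi).le
    r_R := fun i hi => ((D.mem_init_R f i).1 hi).le
    th_ge := fun i hi => (hs i hi).1.le
    th_le := fun i hi => (hs i hi).2.le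
    slope_bot := fun i hi h => absurd h (hs i hi).1.ne'
    slope_top := fun i hi h => absurd h (hs i hi).2.ne
    slope_L := fun _ i hi h => absurd h ((D.mem_init_L f i).1 hi).ne
    slope_R := fun _ i hi h => absurd h ((D.mem_init_R f i).1 hi).ne' }

theorem Data.release_w (s : State n p) : (D.release s).w
    = s.th D.star / (D.tau - if s.th D.star < 0 then 1 else 0) := by
  unfold Data.release
  simp only
  split_ifs <;> rfl

theorem Data.release_w_nonneg (htau0 : 0 < D.tau) (htau1 : D.tau < 1) (s : State n p) :
    0 ≤ (D.release s).w := by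
  rw [D.release_w]
  split_ifs with h
  · exact div_nonneg_of_nonpos h.le (by linarith)
  · exact div_nonneg (not_lt.1 h) (by linarith)

/-- The release weight is the one at which the unchanged dual variable of `star` reaches an end of
its shrinking range. -/
theorem Data.th_star_eq (htau0 : 0 < D.tau) (htau1 : D.tau < 1) (s : State n p) :
    s.th D.star = (D.release s).w * if s.th D.star < 0 then D.tau - 1 else D.tau := by
  rw [D.release_w]
  split_ifs with h
  · rw [div_mul_cancel₀]; linarith
  · rw [sub_zero, div_mul_cancel₀]; linarith

/-- Until the distinguished case leaves the elbow set, the initial fit remains optimal. -/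
theorem Data.Solves.optimal_of_release (hf : D.Solves 1 f) (hgp : D.GeneralPosition)
    (htau0 : 0 < D.tau) (htau1 : D.tau < 1) (hstar : D.star ∈ (D.init f).E) {w : ℝ}
    (hw : (D.release (D.init f)).w ≤ w) : D.Optimal w f (D.init f).th := by
  have hO := hf.init_optimal htau0 htau1 hgp
  have hth := D.th_star_eq htau0 htau1 (D.init f)
  have hw0 := D.release_w_nonneg htau0 htau1 (D.init f)
  have hr := (D.mem_init_E f _).1 hstar
  have hwt : ∀ i, i ≠ D.star → D.weight w i = D.weight 1 i := fun i hi => by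
    simp [Data.weight, hi]
  have hws : D.weight w D.star = w := if_pos rfl
  refine ⟨hO.toStationary, fun i => ?_, fun i => ?_, fun i hi => ?_, fun i hi => ?_⟩
  · by_cases h : i = D.star
    · subst h
      rw [hws]
      split_ifs at hth with h
      · rw [hth]; exact mul_le_mul_of_nonpos_right hw (by linarith)
      · exact (mul_nonpos_of_nonneg_of_nonpos (by linarith) (by linarith)).trans (not_lt.1 h)
    · rw [hwt i h]; exact hO.ge i
  · by_cases h : i = D.star
    · subst h
      rw [hws]
      split_ifs at hth with h
      · exact h.le.trans (mul_nonneg (by linarith) (by linarith))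
      · rw [hth]; exact mul_le_mul_of_nonneg_right hw (by linarith)
    · rw [hwt i h]; exact hO.le i
  · have h : i ≠ D.star := fun e => hi.ne' (e ▸ hr)
    rw [hwt i h]; exact hO.of_pos i hi
  · have h : i ≠ D.star := fun e => hi.ne (e ▸ hr)
    rw [hwt i h]; exact hO.of_neg i hi

/-- The case `star` leaves the elbow with residual zero, so it is the only case at a boundary;
`sgn_mul_slopeR_star_neg` makes its residual move strictly to the correct side. -/
theorem Data.Solves.inv_release (hf : D.Solves 1 f) (hgp : D.GeneralPosition)
    (htau0 : 0 < D.tau) (htau1 : D.tau < 1)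
    (hstart : ∀ i ∈ (D.init f).E, i ≠ D.star →
      D.tau - 1 < (D.init f).th i ∧ (D.init f).th i < D.tau)
    (hstar : D.star ∈ (D.init f).E) (hpos : 0 < (D.release (D.init f)).w) :
    D.Inv (D.release (D.init f)) := by
  have hO := hf.init_optimal htau0 htau1 hgp
  have hth := D.th_star_eq htau0 htau1 (D.init f)
  have hrel : D.release (D.init f) = { D.init f with
      w := (D.release (D.init f)).w
      L := if 0 < (D.init f).th D.star then (D.init f).L else (D.init f).L ∪ {D.star}
      E := (D.init f).E \ {D.star}
      R := if 0 < (D.init f).th D.star then (D.init f).R ∪ {D.star} else (D.init f).R } := by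
    have hp := hpos
    rw [D.release_w] at hp ⊢
    conv_lhs => unfold Data.release
    simp only
    rw [if_pos hp]
  set s := D.init f with hsdef
  set t := D.release s with htdef
  have htE : t.E = s.E \ {D.star} := by rw [hrel]
  have htth : t.th = s.th := by rw [hrel]
  have htf : t.fit = f := by rw [hrel]; rfl
  have htr : t.r = D.resid f := by rw [hrel]; rfl
  have hne0 : s.th D.star ≠ 0 := fun h => by
    rw [htdef, D.release_w, h] at hpos
    simp at hpos
  have hmemE : ∀ i, i ∈ t.E ↔ i ∈ s.E ∧ i ≠ D.star := fun i => by simp [htE]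
  have hmemL : ∀ i, i ≠ D.star → (i ∈ t.L ↔ i ∈ s.L) := fun i hi => by
    rw [hrel]; simp only; split_ifs <;> simp [hi]
  have hmemR : ∀ i, i ≠ D.star → (i ∈ t.R ↔ i ∈ s.R) := fun i hi => by
    rw [hrel]; simp only; split_ifs <;> simp [hi]
  have hr0 : D.resid f D.star = 0 := (D.mem_init_E f _).1 hstar
  have hsL : D.star ∉ s.L := fun h => ((D.mem_init_L f _).1 h).ne hr0
  have hsR : D.star ∉ s.R := fun h => ((D.mem_init_R f _).1 h).ne' hr0
  have hstarLR : (0 < s.th D.star ∧ D.star ∉ t.L ∧ D.star ∈ t.R) ∨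
      (s.th D.star < 0 ∧ D.star ∈ t.L ∧ D.star ∉ t.R) := by
    rcases lt_or_gt_of_ne hne0 with h | h
    · right
      rw [hrel]
      simp [h, h.not_gt, hsR]
    · left
      rw [hrel]
      simp [h, hsL]
  have hsE : ∀ i ∈ t.E, D.tau - 1 < t.th i ∧ t.th i < D.tau := fun i hi => by
    rw [htth]; exact hstart i ((hmemE i).1 hi).1 ((hmemE i).1 hi).2
  have hstarE : D.star ∉ t.E := fun h => ((hmemE _).1 h).2 rfl
  have hslope : t.E.Nonempty → D.sgn t * D.slopeR t D.star < 0 := fun hn => by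
    refine D.sgn_mul_slopeR_star_neg hstarE ((hgp.init_indep f).mono ?_) hn ?_
    · intro i hi
      rcases Finset.mem_insert.1 hi with rfl | hi
      · exact hstar
      · exact ((hmemE i).1 hi).1
    · unfold Data.sgn; split_ifs
      · exact (sub_neg.2 htau1).ne
      · exact htau0.ne'
  have hL : ∀ i ∈ t.L, i = D.star ∨ D.resid f i < 0 := fun i hi => by
    by_cases h : i = D.star
    · exact Or.inl h
    · exact Or.inr ((D.mem_init_L f i).1 ((hmemL i h).1 hi))
  have hR : ∀ i ∈ t.R, i = D.star ∨ 0 < D.resid f i := fun i hi => by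
    by_cases h : i = D.star
    · exact Or.inl h
    · exact Or.inr ((D.mem_init_R f i).1 ((hmemR i h).1 hi))
  exact
  { toStationary := by rw [htf, htth]; exact hO.toStationary
    w_pos := hpos
    star_notMem := hstarE
    cover := fun i => by
      by_cases h : i = D.star
      · subst h; tauto
      · rw [hmemE, hmemL i h, hmemR i h, D.mem_init_L, D.mem_init_E, D.mem_init_R]
        rcases lt_trichotomy (D.resid f i) 0 with h | h | h <;> tauto
    notMem_L := fun i hi => by
      obtain ⟨h1, h2⟩ := (hmemE i).1 hi
      rw [hmemL i h2]
      exact fun h => ((D.mem_init_L f i).1 h).ne ((D.mem_init_E f i).1 h1)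
    notMem_R := fun i hi => by
      obtain ⟨h1, h2⟩ := (hmemE i).1 hi
      rw [hmemR i h2]
      exact fun h => ((D.mem_init_R f i).1 h).ne' ((D.mem_init_E f i).1 h1)
    disjoint := fun i => by
      by_cases h : i = D.star
      · subst h; tauto
      · rw [hmemL i h, hmemR i h, D.mem_init_L, D.mem_init_R]
        exact fun h h' => h.not_gt h'
    r_eq := fun i => by rw [htf, htr]
    th_off := fun i hi => by
      rw [htth]
      by_cases h : i = D.star
      · subst h
        rw [hth, Data.weight, if_pos rfl]
        rcases hstarLR with ⟨h1, h2, -⟩ | ⟨h1, h2, -⟩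
        · rw [if_neg h1.not_gt, if_neg h2]
        · rw [if_pos h1, if_pos h2]
      · rw [Data.weight, if_neg h, one_mul]
        have hr : D.resid f i ≠ 0 := fun e => hi ((hmemE i).2 ⟨(D.mem_init_E f i).2 e, h⟩)
        rcases lt_or_gt_of_ne hr with h' | h'
        · rw [D.init_th_of_neg h', if_pos ((hmemL i h).2 ((D.mem_init_L f i).2 h'))]
        · rw [D.init_th_of_pos h',
            if_neg fun h'' => h'.not_gt ((D.mem_init_L f i).1 ((hmemL i h).1 h''))]
    r_E := fun i hi => by rw [htr]; exact (D.mem_init_E f i).1 ((hmemE i).1 hi).1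
    r_L := fun i hi => by
      rw [htr]
      rcases hL i hi with rfl | h
      · exact hr0.le
      · exact h.le
    r_R := fun i hi => by
      rw [htr]
      rcases hR i hi with rfl | h
      · exact hr0.ge
      · exact h.le
    th_ge := fun i hi => (hsE i hi).1.le
    th_le := fun i hi => (hsE i hi).2.le
    slope_bot := fun i hi h => absurd h (hsE i hi).1.ne'
    slope_top := fun i hi h => absurd h (hsE i hi).2.ne
    slope_L := fun hn i hi h => by
      rw [htr] at h
      rcases hL i hi with rfl | h'
      · have := hslope hn
        rw [Data.sgn, if_pos hi] at this
        exact pos_of_mul_neg_right this (sub_neg.2 htau1).le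
      · exact absurd h h'.ne
    slope_R := fun hn i hi h => by
      rw [htr] at h
      rcases hR i hi with rfl | h'
      · have := hslope hn
        rw [Data.sgn, if_neg (by tauto)] at this
        exact neg_of_mul_neg_right this htau0.le
      · exact absurd h h'.ne' }

end Start

/-! ### Recurrence of a configuration -/

/-- Pair the difference of the dual variables, which is supported on `A`, with the difference of the
slope coefficients. Zero residuals make the fitted difference constant on `A`, so λ‖β - β'‖² is that
constant times a zero sum. Independence then settles θ, and any one case of `A` the intercept. -/
theorem Data.Stationary.unique {D : Data n p} {f g : Fit p} {th th' : Fin n → ℝ}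
    {A : Finset (Fin n)} (hlam : 0 < D.lam) (hI : D.Indep A) (hne : A.Nonempty)
    (h : D.Stationary f th) (h' : D.Stationary g th') (hoff : ∀ i ∉ A, th i = th' i)
    (hf : ∀ i ∈ A, D.resid f i = 0) (hg : ∀ i ∈ A, D.resid g i = 0) : th = th' ∧ f = g := by
  have hsum : ∀ v : Fin n → ℝ, ∑ i ∈ A, (th i - th' i) * v i
      = ∑ i, th i * v i - ∑ i, th' i * v i := by
    intro v
    rw [← Finset.sum_sub_distrib, Finset.sum_subset (Finset.subset_univ A)]
    · exact Finset.sum_congr rfl fun i _ => by ring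
    · intro i _ hi
      rw [hoff i hi, sub_self, zero_mul]
  have h0 : ∑ i ∈ A, (th i - th' i) = 0 := by
    have := hsum 1
    simp only [Pi.one_apply, mul_one] at this
    rw [this, h.sum_eq, h'.sum_eq, sub_self]
  have hx : ∀ i ∈ A, D.x i ⬝ᵥ (f.b - g.b) = g.b0 - f.b0 := fun i hi => by
    have h1 := hf i hi
    have h2 := hg i hi
    rw [Data.resid] at h1 h2
    rw [dotProduct_sub]
    linarith
  have hsq : D.lam * ∑ j, (f.b j - g.b j) ^ 2 = 0 := by
    have h1 := hsum fun i => D.x i ⬝ᵥ (f.b - g.b)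
    rw [h.sum_mul_dotProduct, h'.sum_mul_dotProduct, Finset.sum_congr rfl fun i hi => by rw [hx i hi],
      ← Finset.sum_mul, h0, zero_mul, ← mul_sub, ← Finset.sum_sub_distrib] at h1
    rw [h1]
    congr 1
    exact Finset.sum_congr rfl fun j _ => by rw [Pi.sub_apply]; ring
  have hb : f.b = g.b := by
    have h1 := (mul_eq_zero.1 hsq).resolve_left hlam.ne'
    rw [Finset.sum_eq_zero_iff_of_nonneg fun j _ => sq_nonneg _] at h1
    ext j
    exact sub_eq_zero.1 (pow_eq_zero_iff two_ne_zero |>.1 (h1 j (Finset.mem_univ j)))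
  have hth := hI.coeff_eq_zero (fun i => th i - th' i) fun j => by
    refine Fin.cases ?_ (fun j => ?_) j
    · simpa using h0
    · have := hsum fun i => D.x i j
      rw [← h.coef_eq, ← h'.coef_eq, hb, sub_self] at this
      simpa using this
  refine ⟨funext fun i => ?_, Fit.ext ?_ hb⟩
  · by_cases hi : i ∈ A
    · exact sub_eq_zero.1 (hth i hi)
    · exact hoff i hi
  · obtain ⟨k, hk⟩ := hne
    have := hx k hk
    rw [hb, sub_self, dotProduct_zero] at this
    linarith

/-- Once a configuration of the three sets has been left, it does not recur. -/
theorem Data.Inv.not_recurrent {D : Data n p} {s t : State n p} (h : D.Inv s) (ht : D.Inv t)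
    (hgp : D.GeneralPosition) (hlam : 0 < D.lam) (hne : s.E.Nonempty)
    (hhit : ∃ i, D.HitsElbow s i ∨ D.HitsSide s i) (hw : t.w < D.nextW s)
    (hL : t.L = s.L) (hE : t.E = s.E) (hR : t.R = s.R) : False := by
  -- So `t` lies on the line of the segment from `s`, strictly past its end.
  obtain ⟨hth, hfit⟩ := Data.Stationary.unique hlam (h.indep hgp) hne ht.toStationary
    (h.stationary_fitAt hgp hlam hne t.w)
    (fun i hi => by rw [ht.th_off i (hE ▸ hi), Data.thAt, if_neg hi, Data.weight, hL])
    (fun i hi => by rw [← ht.r_eq, ht.r_E i (hE ▸ hi)])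
    (fun i hi => by rw [← h.rAt_eq hgp hne, h.rAt_elbow hgp _ hi])
  obtain ⟨i, hi | hi⟩ := hhit
  · obtain ⟨hiE, hi⟩ := Data.HitsElbow.spec h hi
    have h1 := ht.th_le i (hE ▸ hiE)
    have h2 := ht.th_ge i (hE ▸ hiE)
    rw [hth, Data.thAt, if_pos hiE] at h1 h2
    rw [Data.thAt, if_pos hiE] at hi
    rcases hi with ⟨hi, hs⟩ | ⟨hi, hs⟩
    · have := mul_lt_mul_of_neg_left hw hs
      linarith
    · have := mul_lt_mul_of_pos_left hw hs
      linarith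
  · obtain ⟨hr0, hi⟩ := Data.HitsSide.spec h hlam hi
    have hdiff : t.r i = D.slopeR s i / D.lam * (t.w - D.nextW s) := by
      rw [ht.r_eq, hfit, ← h.rAt_eq hgp hne, ← sub_zero (D.rAt s t.w i), ← hr0, Data.rAt,
        Data.rAt]
      ring
    rcases hi with ⟨hiL, hs⟩ | ⟨hiR, hs⟩
    · have h1 := ht.r_L i (hL ▸ hiL)
      rw [hdiff] at h1
      exact h1.not_gt (mul_pos_of_neg_of_neg (div_neg_of_neg_of_pos hs hlam) (sub_neg.2 hw))
    · have h1 := ht.r_R i (hR ▸ hiR)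
      rw [hdiff] at h1
      exact h1.not_gt (mul_neg_of_pos_of_neg (div_pos hs hlam) (sub_neg.2 hw))

/-! ### The whole path -/

section Run

variable {D : Data n p} {f : Fit p}

theorem Data.run_succ_release (hs : D.star ∈ (D.run f 0).E) :
    D.run f 1 = D.release (D.init f) := by
  rw [Data.run, if_pos ⟨rfl, hs⟩]
  rfl

theorem Data.run_succ_loop {m : ℕ} (hm : ¬ (m = 0 ∧ D.star ∈ (D.run f 0).E))
    (hw : 0 < (D.run f m).w) : D.run f (m + 1) = D.loopStep (D.run f m) := by
  rw [Data.run]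
  rw [if_neg, if_pos hw]
  rintro ⟨rfl, h⟩
  exact hm ⟨rfl, h⟩

theorem Data.WellDefinedAt.spec {m : ℕ} (h : D.WellDefinedAt f m)
    (hm : ¬ (m = 0 ∧ D.star ∈ (D.run f 0).E)) (hw : 0 < (D.run f m).w) :
    (D.run f m).E.Nonempty ∧ (0 < D.nextW (D.run f m) →
      ∃! i, D.HitsElbow (D.run f m) i ∨ D.HitsSide (D.run f m) i) := by
  have := h (by rintro ⟨rfl, h⟩; exact hm ⟨rfl, h⟩) hw
  rwa [D.run_succ_loop hm hw, D.loopStep_w] at this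

theorem Data.run_w_nonneg (htau0 : 0 < D.tau) (htau1 : D.tau < 1) (m : ℕ) :
    0 ≤ (D.run f m).w := by
  induction m with
  | zero => exact zero_le_one
  | succ m ih =>
    rw [Data.run]
    split_ifs with h1 h2
    · exact D.release_w_nonneg htau0 htau1 _
    · rw [D.loopStep_w]
      exact (D.nextW_mem h2).1
    · exact ih

/-- The start with `star` on the elbow is excluded because the invariant needs `star` off it; there
the invariant first holds after the release. -/
theorem Data.Solves.inv_run (hf : D.Solves 1 f) (hgp : D.GeneralPosition) (hlam : 0 < D.lam)
    (htau0 : 0 < D.tau) (htau1 : D.tau < 1)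
    (hstart : ∀ i ∈ (D.run f 0).E, i ≠ D.star →
      D.tau - 1 < (D.run f 0).th i ∧ (D.run f 0).th i < D.tau)
    (m : ℕ) (hwd : ∀ k < m, D.WellDefinedAt f k) (hw : 0 < (D.run f m).w)
    (hm : ¬ (m = 0 ∧ D.star ∈ (D.run f 0).E)) : D.Inv (D.run f m) := by
  induction m with
  | zero => exact hf.inv_init hgp htau0 htau1 hstart fun h => hm ⟨rfl, h⟩
  | succ m ih =>
    by_cases h1 : m = 0 ∧ D.star ∈ (D.run f 0).E
    · obtain ⟨rfl, hs⟩ := h1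
      rw [zero_add, D.run_succ_release hs] at hw ⊢
      exact hf.inv_release hgp htau0 htau1 hstart hs hw
    · by_cases h2 : 0 < (D.run f m).w
      · have hI := ih (fun k hk => hwd k (hk.trans m.lt_succ_self)) h2 h1
        obtain ⟨hne, hu⟩ := (hwd m m.lt_succ_self).spec h1 h2
        rw [D.run_succ_loop h1 h2] at hw ⊢
        rw [D.loopStep_w] at hw
        exact hI.loopStep hgp hlam htau0 htau1 hne hw (hu hw)
      · exfalso
        rw [Data.run] at hw
        rw [if_neg, if_neg h2] at hw
        · exact h2 hw
        · rintro ⟨rfl, h⟩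
          exact h1 ⟨rfl, h⟩

/-- The path solves the case-weight adjusted problem down to a breakpoint, if all passes before it
are well-defined. -/
theorem Data.Solves.path (hf : D.Solves 1 f) (hgp : D.GeneralPosition) (hlam : 0 < D.lam)
    (htau0 : 0 < D.tau) (htau1 : D.tau < 1)
    (hstart : ∀ i ∈ (D.run f 0).E, i ≠ D.star →
      D.tau - 1 < (D.run f 0).th i ∧ (D.run f 0).th i < D.tau)
    (M : ℕ) (hwd : ∀ k < M, D.WellDefinedAt f k) (w : ℝ) (hMw : (D.run f M).w ≤ w) (hw1 : w ≤ 1) :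
    D.Solves w (D.path f w) := by
  rcases hw1.eq_or_lt with rfl | hw1
  · rw [Data.path, if_pos le_rfl]
    exact hf
  have hw0 : 0 ≤ w := (D.run_w_nonneg htau0 htau1 M).trans hMw
  rw [Data.path, if_neg (not_le.2 hw1)]
  simp only
  set S := {m : ℕ | (D.run f (m + 1)).w ≤ w} with hS
  obtain ⟨M, rfl⟩ : ∃ k, M = k + 1 := by
    refine Nat.exists_eq_succ_of_ne_zero ?_
    rintro rfl
    exact hMw.not_gt hw1
  have hMS : M ∈ S := hMw
  have hmS : (D.run f (sInf S + 1)).w ≤ w := Nat.sInf_mem (s := S) ⟨M, hMS⟩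
  have hmM : sInf S ≤ M := Nat.sInf_le hMS
  -- By minimality of the infimum, `w` lies at or above breakpoint `sInf S + 1` and strictly below
  -- breakpoint `sInf S`; index 0 has weight one.
  have hmw : w < (D.run f (sInf S)).w := by
    rcases Nat.eq_zero_or_pos (sInf S) with h | h
    · rw [h]; exact hw1
    · obtain ⟨k, hk⟩ := Nat.exists_eq_succ_of_ne_zero h.ne'
      have : k ∉ S := Nat.notMem_of_lt_sInf (hk ▸ k.lt_succ_self)
      rw [hk]
      exact not_le.1 this
  set m := sInf S
  split_ifs with hm
  · obtain ⟨hm0, hs⟩ := hm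
    rw [hm0, zero_add, D.run_succ_release hs] at hmS
    exact (hf.optimal_of_release hgp htau0 htau1 hs hmS).solves hlam
  · have hpos : 0 < (D.run f m).w := hw0.trans_lt hmw
    have hI := hf.inv_run hgp hlam htau0 htau1 hstart m
      (fun k hk => hwd k (by omega)) hpos hm
    obtain ⟨hne, -⟩ := (hwd m (by omega)).spec hm hpos
    rw [D.run_succ_loop hm hpos, D.loopStep_w] at hmS
    exact (hI.optimal_fitAt hgp hlam htau0 htau1 hne hw0 hmS hmw.le).solves hlam

/-- If all passes are well-defined, then the weight zero is reached after finitely many steps. -/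
theorem Data.Solves.exists_run_w_eq_zero (hf : D.Solves 1 f) (hgp : D.GeneralPosition)
    (hlam : 0 < D.lam) (htau0 : 0 < D.tau) (htau1 : D.tau < 1)
    (hstart : ∀ i ∈ (D.run f 0).E, i ≠ D.star →
      D.tau - 1 < (D.run f 0).th i ∧ (D.run f 0).th i < D.tau)
    (hwd : ∀ k, D.WellDefinedAt f k) : ∃ M, (D.run f M).w = 0 := by
  by_contra! hne0
  have hpos : ∀ m, 0 < (D.run f m).w := fun m =>
    lt_of_le_of_ne (D.run_w_nonneg htau0 htau1 m) (hne0 m).symm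
  have hm : ∀ m, ¬ (m + 1 = 0 ∧ D.star ∈ (D.run f 0).E) := fun m h => m.succ_ne_zero h.1
  have hI : ∀ m, D.Inv (D.run f (m + 1)) := fun m =>
    hf.inv_run hgp hlam htau0 htau1 hstart (m + 1) (fun k _ => hwd k) (hpos _) (hm m)
  have hnext : ∀ m, (D.run f (m + 1 + 1)).w = D.nextW (D.run f (m + 1)) := fun m => by
    rw [D.run_succ_loop (hm m) (hpos _), D.loopStep_w]
  have hanti : StrictAnti fun m => (D.run f (m + 1)).w := strictAnti_nat_of_succ_lt fun m => by
    rw [hnext]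
    exact (D.nextW_mem (hpos _)).2
  -- Only every second state is compared: `not_recurrent` needs a weight strictly below the end of
  -- the segment, and the very next state sits exactly at that end. The `+ 1` skips the initial
  -- state, where the invariant may fail.
  have hno : ∀ a b, a < b →
      ((D.run f (2 * a + 1)).L, (D.run f (2 * a + 1)).E, (D.run f (2 * a + 1)).R)
        ≠ ((D.run f (2 * b + 1)).L, (D.run f (2 * b + 1)).E, (D.run f (2 * b + 1)).R) := by
    intro a b hab e
    simp only [Prod.mk.injEq] at e
    obtain ⟨hne, hu⟩ := (hwd (2 * a + 1)).spec (hm _) (hpos _)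
    have hp : 0 < D.nextW (D.run f (2 * a + 1)) := hnext (2 * a) ▸ hpos _
    refine (hI (2 * a)).not_recurrent (hI (2 * b)) hgp hlam hne (hu hp).exists ?_
      e.1.symm e.2.1.symm e.2.2.symm
    rw [← hnext]
    exact hanti (show 2 * a + 1 < 2 * b by omega)
  obtain ⟨a, b, hab, e⟩ := Finite.exists_ne_map_eq_of_infinite fun m =>
    ((D.run f (2 * m + 1)).L, (D.run f (2 * m + 1)).E, (D.run f (2 * m + 1)).R)
  rcases lt_or_gt_of_ne hab with h | h
  · exact hno a b h e
  · exact hno b a h e.symm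

end Run

end QRPath

end

theorem theorem1 {n p : ℕ} (D : QRPath.Data n p) (f : QRPath.Fit p)
    (htau0 : 0 < D.tau) (htau1 : D.tau < 1) (hlam : 0 < D.lam)
    (hgp : D.GeneralPosition)
    (hfull : D.Solves 1 f)
    (hstart : ∀ i ∈ (D.run f 0).E, i ≠ D.star →
      D.tau - 1 < (D.run f 0).th i ∧ (D.run f 0).th i < D.tau) :
    (∀ M : ℕ, (∀ m < M, D.WellDefinedAt f m) →
      ∀ w : ℝ, (D.run f M).w ≤ w → w ≤ 1 → D.Solves w (D.path f w)) ∧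
    ((∀ m : ℕ, D.WellDefinedAt f m) →
      (∃ M : ℕ, (D.run f M).w = 0) ∧
      (∀ w : ℝ, 0 ≤ w → w ≤ 1 → D.Solves w (D.path f w)) ∧
      D.SolvesLOO (D.path f 0)) := by
  have hpath := hfull.path hgp hlam htau0 htau1 hstart
  refine ⟨hpath, fun hwd => ?_⟩
  obtain ⟨M, hM⟩ := hfull.exists_run_w_eq_zero hgp hlam htau0 htau1 hstart hwd
  have hall : ∀ w : ℝ, 0 ≤ w → w ≤ 1 → D.Solves w (D.path f w) := fun w hw0 hw1 =>
    hpath M (fun k _ => hwd k) w (hM ▸ hw0) hw1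
  refine ⟨⟨M, hM⟩, hall, fun g => ?_⟩
  have := hall 0 le_rfl zero_le_one g
  simpa [QRPath.Data.objective, QRPath.Data.looObjective] using this
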